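/- Let $\mathsf{Ag}$ be a finite nonempty set of agents (linearly ordered in some way) and let $\mathsf{Prop}=\{p_0,p_1,\dots\}$ be a countably infinite set of propositional variables. For $X\subseteq\{C,D,M\}$, the formulas of the language $\mathcal{EL}X$ are built from variables $p$ by $\neg\varphi$, $(\varphi\to\psi)$, $K_a\varphi$ ($a\in\mathsf{Ag}$) and, for each letter $O\in X$ and each nonempty group $G\subseteq\mathsf{Ag}$, $O_G\varphi$. A model $M=(W,A,E,C,\nu)$ consists of a nonempty set $W$ of states, a set $A$ of abilities, an edge function $E:W\times W\to\wp(A)$, a capability function $C:\mathsf{Ag}\to\wp(A)$ and a valuation $\nu:W\to\wp(\mathsf{Prop})$. It is a similarity model if, for all $s,t\in W$, $E(s,t)=A$ implies $s=t$, and $E(s,t)=E(t,s)$. Satisfaction is defined as usual for variables, $\neg$ and $\to$, and by - $M,s\models K_a\psi$ iff $M,t\models\psi$ for all $t\in W$ with $C(a)\subseteq E(s,t)$; - $M,s\models C_G\psi$ iff $M,s\models E_G^n\psi$ for all $n\ge 1$, where $E_G\psi=\bigwedge_{a\in G}K_a\psi$ and $E_G^n$ is its $n$-fold iteration; - $M,s\models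 D_G\psi$ iff $M,t\models\psi$ for all $t\in W$ with $\bigcup_{a\in G}C(a)\subseteq E(s,t)$; - $M,s\models M_G\psi$ iff $M,t\models\psi$ for all $t\in W$ with $\bigcap_{a\in G}C(a)\subseteq E(s,t)$. The eight sets $X$, each combined with either the class of all models or the class of similarity models, give sixteen logics. The model checking problem of such a logic asks, for a formula $\varphi$ of $\mathcal{EL}X$, a finite model $M$ ($W$ and $A$ finite) in the chosen class and a state $s$ of $M$, whether $M,s\models\varphi$. An instance, with $W=\{0,\dots,n-1\}$ and $A=\{0,\dots,m-1\}$, is written as a word over a finite alphabet that has one letter for each agent: $n$, $m$ and $s$ in unary; $\varphi$ in prefix notation, with the indices of variables in binary and the agents of a group listed in order; the $n^2m$ bits of $E$; the $|\mathsf{Ag}|\cdot m$ bits of $C$; and, for each occurrence of a variable in $\varphi$, the $n$ bits that say at which states it is true. **Theorem.** For each of the sixteen logics the model checking problem is in P: there is a language, decided by a deterministic Turing machine in time polynomial in the length of the input word, which contains the word of an instance $(M,s,\varphi)$ if and only if $M,s\models\varphi$, and which contains no word other than words of instances. Moreover, the length of the word of an instance is bounded by a polynomial in $|\varphi|+|M|+1$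 and the largest number of binary digits of the index of a variable in $\varphi$. Here $|\varphi|$ is the number of symbols of $\varphi$, each variable and each agent counting as one symbol and all brackets and commas included (so $|C_G\psi|=|\psi|+2|G|+2$, and likewise for $D_G$ and $M_G$), and $|M|=|W|+|A|+|W|^2|A|+|\varphi||A|+|W||\varphi|$. -/

import Mathlib

namespace WeightedEpistemic

/-! ### Formulas -/

/-- A group: a nonempty (finite) set of agents. -/
abbrev AgentGroup (Ag : Type) : Type := {G : Finset Ag // G.Nonempty}

/-- Formulas of the largest language; propositional variables are the natural numbers. -/
inductive Formula (Ag : Type) : Type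
  | var (p : ℕ)
  | neg (φ : Formula Ag)
  | imp (φ ψ : Formula Ag)
  | knows (a : Ag) (φ : Formula Ag)
  | commonK (G : AgentGroup Ag) (φ : Formula Ag)
  | distributedK (G : AgentGroup Ag) (φ : Formula Ag)
  | mutualK (G : AgentGroup Ag) (φ : Formula Ag)

/-- The three kinds of group knowledge operators that a language may contain. -/
inductive GroupOp : Type
  | C
  | D
  | M

namespace Formula

variable {Ag : Type}

/-- `φ.InLang X`: the only group operators occurring in `φ` are those of kinds in `X`.
The eight sets `X` give the eight languages EL, ELC, ELD, ELM, ELCD, ELCM, ELDM, ELCDM. -/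
def InLang (X : Set GroupOp) : Formula Ag → Prop
  | var _ => True
  | neg φ => φ.InLang X
  | imp φ ψ => φ.InLang X ∧ ψ.InLang X
  | knows _ φ => φ.InLang X
  | commonK _ φ => GroupOp.C ∈ X ∧ φ.InLang X
  | distributedK _ φ => GroupOp.D ∈ X ∧ φ.InLang X
  | mutualK _ φ => GroupOp.M ∈ X ∧ φ.InLang X

/-- The length `|φ|`: the number of symbols, brackets included, a variable counting as one. -/
def length : Formula Ag → ℕ
  | var _ => 1
  | neg φ => φ.length + 1
  | imp φ ψ => φ.length + ψ.length + 3
  | knows _ φ => φ.length + 2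
  | commonK G φ => φ.length + 2 * G.1.card + 2
  | distributedK G φ => φ.length + 2 * G.1.card + 2
  | mutualK G φ => φ.length + 2 * G.1.card + 2

/-- The list of the occurrences of variables in `φ`, from left to right. -/
def varOccs : Formula Ag → List ℕ
  | var p => [p]
  | neg φ => φ.varOccs
  | imp φ ψ => φ.varOccs ++ ψ.varOccs
  | knows _ φ => φ.varOccs
  | commonK _ φ => φ.varOccs
  | distributedK _ φ => φ.varOccs
  | mutualK _ φ => φ.varOccs

/-- The largest number of binary digits of the index of a variable occurring in `φ`. -/
def nameLength : Formula Ag → ℕ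
  | var p => (Computability.encodeNat p).length
  | neg φ => φ.nameLength
  | imp φ ψ => max φ.nameLength ψ.nameLength
  | knows _ φ => φ.nameLength
  | commonK _ φ => φ.nameLength
  | distributedK _ φ => φ.nameLength
  | mutualK _ φ => φ.nameLength

end Formula

/-! ### Models and satisfaction -/

/-- A model with domain `W` and set of abilities `A` (possibly empty or infinite).
Nonemptiness of `W` is not a field: a pointed model has a state. -/
structure Model (Ag W A : Type) : Type where
  /-- the edge function -/
  edge : W → W → Set A
  /-- the capability function -/
  cap : Ag → Set A
  /-- the valuation -/
  val : W → Set ℕ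

namespace Model

variable {Ag W A : Type}

/-- Similarity models: positivity and symmetry of the edge function. -/
def IsSimilarity (M : Model Ag W A) : Prop :=
  (∀ s t, M.edge s t = Set.univ → s = t) ∧ ∀ s t, M.edge s t = M.edge t s

/-- The states at which everyone in `G` knows the proposition `S`, i.e. the truth set of
the conjunction of all `K_a ψ` with `a` in `G`, when `S` is the truth set of `ψ`. -/
def everyone (M : Model Ag W A) (G : AgentGroup Ag) (S : Set W) : Set W :=
  {s | ∀ a ∈ G.1, ∀ t, M.cap a ⊆ M.edge s t → t ∈ S}

/-- Satisfaction. In the clause for common knowledge, `(M.everyone G)^[n]` applied to the truth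
set of `φ` is the truth set of the `n`-fold iteration of everyone's knowledge of `φ`. -/
def Sat (M : Model Ag W A) : Formula Ag → W → Prop
  | .var p, s => p ∈ M.val s
  | .neg φ, s => ¬ M.Sat φ s
  | .imp φ ψ, s => M.Sat φ s → M.Sat ψ s
  | .knows a φ, s => ∀ t, M.cap a ⊆ M.edge s t → M.Sat φ t
  | .commonK G φ, s => ∀ n : ℕ, 1 ≤ n → s ∈ (M.everyone G)^[n] {t | M.Sat φ t}
  | .distributedK G φ, s => ∀ t, (⋃ a ∈ G.1, M.cap a) ⊆ M.edge s t → M.Sat φ t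
  | .mutualK G φ, s => ∀ t, (⋂ a ∈ G.1, M.cap a) ⊆ M.edge s t → M.Sat φ t

end Model

/-! ### The class P -/

open Classical in
/-- The class P of languages over the alphabet `Γ`: those whose characteristic function is computed
by a (multi-stack) Turing machine in time polynomial in the length of the input word. -/
def P (Γ : Type) : Set (Language Γ) :=
  {L | Nonempty (Turing.TM2ComputableInPolyTime (fun w : List Γ => w) Computability.encodeBool
    (fun w => decide (w ∈ L)))}

/-- The decision problem with instances `x : I`, written as words `code x`, and yes-instances `Yes`
is in P: some language in P contains the code of an instance exactly when the instance is a
yes-instance, and contains no word that is not the code of an instance. -/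
def ProblemInP {I Γ : Type} (code : I → List Γ) (Yes : I → Prop) : Prop :=
  ∃ L ∈ P Γ, (∀ x, code x ∈ L ↔ Yes x) ∧ ∀ w ∈ L, ∃ x, code x = w

/-! ### The model checking problem -/

/-- An instance of the model checking problem for the logic with group operators from `X` over all
models (`sim = false`) or over similarity models (`sim = true`): a finite model, whose states are
`0, …, numStates - 1` and whose abilities are `0, …, numAbilities - 1`, a state, and a formula. -/
structure MCInstance (Ag : Type) (X : Set GroupOp) (sim : Bool) : Type where
  numStates : ℕ
  numAbilities : ℕ
  model : Model Ag (Fin numStates) (Fin numAbilities)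
  state : Fin numStates
  formula : Formula Ag
  formula_inLang : formula.InLang X
  model_similarity : sim = true → model.IsSimilarity

/-- The input alphabet: a letter for each agent, the two binary digits, the connectives and
modalities, and a separator. -/
inductive Letter (Ag : Type) : Type
  | agent (a : Ag)
  | bit (b : Bool)
  | var
  | neg
  | imp
  | knows
  | commonK
  | distributedK
  | mutualK
  | sep

section Code

variable {Ag : Type}

/-- The members of a set of agents, each written as one letter, in increasing order. -/
def agentLetters [LinearOrder Ag] (G : Finset Ag) : List (Letter Ag) :=
  (G.sort (· ≤ ·)).map Letter.agent

/-- A formula in prefix notation, the index of a variable being written in binary. -/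
def Formula.code [LinearOrder Ag] : Formula Ag → List (Letter Ag)
  | .var p => Letter.var :: (Computability.encodeNat p).map Letter.bit
  | .neg φ => Letter.neg :: φ.code
  | .imp φ ψ => Letter.imp :: (φ.code ++ ψ.code)
  | .knows a φ => Letter.knows :: Letter.agent a :: φ.code
  | .commonK G φ => Letter.commonK :: (agentLetters G.1 ++ φ.code)
  | .distributedK G φ => Letter.distributedK :: (agentLetters G.1 ++ φ.code)
  | .mutualK G φ => Letter.mutualK :: (agentLetters G.1 ++ φ.code)

/-- A natural number in unary. -/
def unary (n : ℕ) : List (Letter Ag) := List.replicate n (Letter.bit true)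

open Classical in
/-- A subset of `{0, …, n - 1}` as its characteristic word of length `n`. -/
noncomputable def setCode {n : ℕ} (S : Set (Fin n)) : List (Letter Ag) :=
  (List.finRange n).map fun i => Letter.bit (decide (i ∈ S))

/-- The edge function as the concatenation of the words of `E(s, t)`. -/
noncomputable def edgeCode {n m : ℕ} (M : Model Ag (Fin n) (Fin m)) : List (Letter Ag) :=
  (List.finRange n).flatMap fun s => (List.finRange n).flatMap fun t => setCode (M.edge s t)

/-- The capability function as the concatenation of the words of `C(a)`, in the order of agents. -/
noncomputable def capCode [Fintype Ag] [LinearOrder Ag] {n m : ℕ}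
    (M : Model Ag (Fin n) (Fin m)) : List (Letter Ag) :=
  ((Finset.univ : Finset Ag).sort (· ≤ ·)).flatMap fun a => setCode (M.cap a)

/-- The part of the valuation that matters for `φ`: for each occurrence of a variable in `φ`,
the word of the set of states at which the variable is true. -/
noncomputable def valCode {n m : ℕ} (M : Model Ag (Fin n) (Fin m)) (φ : Formula Ag) :
    List (Letter Ag) :=
  φ.varOccs.flatMap fun p => setCode {s | p ∈ M.val s}

variable {X : Set GroupOp} {sim : Bool}

/-- The word that represents an instance. -/
noncomputable def MCInstance.code [Fintype Ag] [LinearOrder Ag] (x : MCInstance Ag X sim) :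
    List (Letter Ag) :=
  unary x.numStates ++ Letter.sep :: (unary x.numAbilities ++ Letter.sep ::
    (unary x.state.val ++ Letter.sep :: (x.formula.code ++ Letter.sep ::
      (edgeCode x.model ++ Letter.sep :: (capCode x.model ++ Letter.sep ::
        valCode x.model x.formula)))))

/-- The question asked by an instance: is the formula true at the state of the model? -/
def MCInstance.Yes (x : MCInstance Ag X sim) : Prop := x.model.Sat x.formula x.state

/-- The size of the input, `|φ| + |M| + 1`, where
`|M| = |W| + |A| + |W|² |A| + |φ| |A| + |W| |φ|`. -/
def MCInstance.size (x : MCInstance Ag X sim) : ℕ :=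
  x.formula.length +
    (x.numStates + x.numAbilities + x.numStates ^ 2 * x.numAbilities +
      x.formula.length * x.numAbilities + x.numStates * x.formula.length) + 1

end Code

end WeightedEpistemic

/-! Model checking works bottom-up: for each subformula one computes its truth set, a list of `|W|`
bits. Every modality is a box along a relation that is decided by running through the abilities. For
`D_G`, the union of the capabilities lies in `E(s, t)` iff each `C(a)` does, and `K_a` is the case
of a singleton; for `M_G` one tests the abilities common to all agents of `G`. For `C_G`, let `S` be
the truth set of the argument and `A j` the set of states satisfying the conditions `E_G^k` with `1
≤ k ≤ j`. Then `A 0` is everything and `A (j + 1)` is the set of states where everyone in `G` knows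
`S ∩ A j`. The chain decreases, and once it stops it stops forever, so it is constant from `A |W|`
on (`eq_of_antitone_iterate`, `common_setBits`). Hence `|W|` boxes suffice. Similarity of the model
is a direct test on the bits of `E`.

The other half is to obtain an actual machine. Structured stack programs compile to `TM2` machines
without loss of time (`StackProg.Run.reaches`). Data are binary trees, kept as prefix codes on one
main stack. `PolyTime` says that a program replaces the code of `a` on top of that stack by the code
of `f a`, whatever lies below, with polynomial bounds on both time and output size. This class is
closed under composition, pairing, case distinction (`treeCases`) and iteration with polynomially
bounded intermediate values (`iterate'`), hence under folds, maps and bounded quantifiers. The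
decision procedure is then an ordinary function, shown to be in the class by its shape, and
`PolyTime.mem_P` returns to languages.

Words are evaluated from right to left, which turns prefix notation into a stack evaluation: the
arguments of an operator are on the stack when it is met. The same pass takes the bits of the
valuation from the end. Two facts make it correct. On the code of a formula it yields the truth set
(`evalWord_code`). Conversely, a word on which it succeeds is made of codes of formulas (`EvalInv`,
`evalInv_evalWord`). Since truth values are given per occurrence, a valuation realizing them exists
only if occurrences of the same variable agree, and this is tested as well
(`exists_of_decideParts`). -/

open Turing

set_option linter.unusedSectionVars false

/-! ### Structured programs on stacks -/

/-- Structured programs acting on a family of stacks and a register with values in `σ`. -/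
inductive StackProg {K : Type} (Γ : K → Type) (σ : Type) : Type
  | push (k : K) (f : σ → Γ k)
  | pop (k : K) (f : σ → Option (Γ k) → σ)
  | load (f : σ → σ)
  | seq (p q : StackProg Γ σ)
  | branch (f : σ → Bool) (p q : StackProg Γ σ)
  | loop (f : σ → Bool) (p : StackProg Γ σ)

namespace StackProg

variable {K : Type} {Γ : K → Type} {σ : Type}

section Semantics

variable [DecidableEq K]

/-- `p.Run v S t v' S'`: started with register `v` and stacks `S`, the program `p` terminates
within `t` steps with register `v'` and stacks `S'`. -/
inductive Run : StackProg Γ σ → σ → (∀ k, List (Γ k)) → ℕ → σ → (∀ k, List (Γ k)) → Prop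
  | push (k f v S) : Run (push k f) v S 1 v (Function.update S k (f v :: S k))
  | pop (k f v S) : Run (pop k f) v S 1 (f v (S k).head?) (Function.update S k (S k).tail)
  | load (f v S) : Run (load f) v S 1 (f v) S
  | seq {p q v S t v' S' t' v'' S''} :
      Run p v S t v' S' → Run q v' S' t' v'' S'' → Run (seq p q) v S (t + t') v'' S''
  | branch_true {f p q v S t v' S'} :
      f v = true → Run p v S t v' S' → Run (branch f p q) v S (t + 1) v' S'
  | branch_false {f p q v S t v' S'} :
      f v = false → Run q v S t v' S' → Run (branch f p q) v S (t + 1) v' S'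
  | loop_false {f p v S} : f v = false → Run (loop f p) v S 1 v S
  | loop_true {f p v S t v' S' t' v'' S''} :
      f v = true → Run p v S t v' S' → Run (loop f p) v' S' t' v'' S'' →
        Run (loop f p) v S (t + t' + 1) v'' S''
  | weaken {p v S t v' S' t'} : Run p v S t v' S' → t ≤ t' → Run p v S t' v' S'

end Semantics

/-- The labels of the compiled program. -/
def Lab : StackProg Γ σ → Type
  | push _ _ => Unit
  | pop _ _ => Unit
  | load _ => Unit
  | seq p q => Lab p ⊕ Lab q
  | branch _ p q => Option (Lab p ⊕ Lab q)
  | loop _ p => Option (Lab p)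

instance finite_lab : ∀ p : StackProg Γ σ, Finite (Lab p)
  | push _ _ => inferInstanceAs (Finite Unit)
  | pop _ _ => inferInstanceAs (Finite Unit)
  | load _ => inferInstanceAs (Finite Unit)
  | seq p q =>
    have := finite_lab p
    have := finite_lab q
    inferInstanceAs (Finite (Lab p ⊕ Lab q))
  | branch _ p q =>
    have := finite_lab p
    have := finite_lab q
    inferInstanceAs (Finite (Option (Lab p ⊕ Lab q)))
  | loop _ p =>
    have := finite_lab p
    inferInstanceAs (Finite (Option (Lab p)))

/-- The entry label. -/
def start : ∀ p : StackProg Γ σ, Lab p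
  | push _ _ => ()
  | pop _ _ => ()
  | load _ => ()
  | seq p _ => Sum.inl (start p)
  | branch _ _ _ => none
  | loop _ _ => none

/-- The statement at a label, when the labels are embedded by `emb` and `ex` is the label to go to
at the end. -/
def compile {Λ : Type} : ∀ p : StackProg Γ σ, (Lab p → Λ) → Λ → Lab p → TM2.Stmt Γ Λ σ
  | push k f, _, ex, _ => .push k f (.goto fun _ => ex)
  | pop k f, _, ex, _ => .pop k f (.goto fun _ => ex)
  | load f, _, ex, _ => .load f (.goto fun _ => ex)
  | seq p q, emb, _, Sum.inl l => compile p (fun l => emb (Sum.inl l)) (emb (Sum.inr (start q))) l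
  | seq _ q, emb, ex, Sum.inr l => compile q (fun l => emb (Sum.inr l)) ex l
  | branch f p q, emb, _, none =>
      .branch f (.goto fun _ => emb (some (Sum.inl (start p))))
        (.goto fun _ => emb (some (Sum.inr (start q))))
  | branch _ p _, emb, ex, some (Sum.inl l) => compile p (fun l => emb (some (Sum.inl l))) ex l
  | branch _ _ q, emb, ex, some (Sum.inr l) => compile q (fun l => emb (some (Sum.inr l))) ex l
  | loop f p, emb, ex, none =>
      .branch f (.goto fun _ => emb (some (start p))) (.goto fun _ => ex)
  | loop _ p, emb, _, some l => compile p (fun l => emb (some l)) (emb none) l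

variable [DecidableEq K]

/-- `Reaches M n c c'`: the machine gets from `c` to `c'` in `n` steps. -/
def Reaches {Λ : Type} (M : Λ → TM2.Stmt Γ Λ σ) (n : ℕ) (c c' : TM2.Cfg Γ Λ σ) : Prop :=
  (flip bind (TM2.step M))^[n] (some c) = some c'

theorem Reaches.trans {Λ : Type} {M : Λ → TM2.Stmt Γ Λ σ} {n m : ℕ} {a b c : TM2.Cfg Γ Λ σ}
    (h : Reaches M n a b) (h' : Reaches M m b c) : Reaches M (n + m) a c := by
  unfold Reaches at *
  rw [Nat.add_comm, Function.iterate_add_apply, h, h']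

theorem Reaches.single {Λ : Type} {M : Λ → TM2.Stmt Γ Λ σ} {l : Λ} {v : σ}
    {S : ∀ k, List (Γ k)} {q : TM2.Stmt Γ Λ σ} {c : TM2.Cfg Γ Λ σ} (hl : M l = q)
    (h : TM2.stepAux q v S = c) : Reaches M 1 ⟨some l, v, S⟩ c := by
  subst hl h
  rfl

/-- Induction on the run, for all ambient machines at once: a subprogram only needs its own labels
to carry its compiled statements, and its exit label may be anything. The exit of the first half of
a sequence is the entry of the second, and the exit of a loop body is the head of the loop. -/
theorem Run.reaches {p : StackProg Γ σ} {v S t v' S'} (h : Run p v S t v' S') :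
    ∀ {Λ : Type} (M : Λ → TM2.Stmt Γ Λ σ) (emb : Lab p → Λ) (ex : Λ),
      (∀ l, M (emb l) = compile p emb ex l) →
      ∃ n ≤ t, Reaches M n ⟨some (emb (start p)), v, S⟩ ⟨some ex, v', S'⟩ := by
  induction h with
  | push k f v S =>
    intro Λ M emb ex hM
    exact ⟨1, le_rfl, Reaches.single (hM ()) rfl⟩
  | pop k f v S =>
    intro Λ M emb ex hM
    exact ⟨1, le_rfl, Reaches.single (hM ()) rfl⟩
  | load f v S =>
    intro Λ M emb ex hM
    exact ⟨1, le_rfl, Reaches.single (hM ()) rfl⟩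
  | @seq p q v S t v' S' t' v'' S'' _ _ ih ih' =>
    intro Λ M emb ex hM
    obtain ⟨n, hn, h⟩ := ih M (fun l => emb (Sum.inl l)) (emb (Sum.inr (start q)))
      (fun l => hM (Sum.inl l))
    obtain ⟨n', hn', h'⟩ := ih' M (fun l => emb (Sum.inr l)) ex (fun l => hM (Sum.inr l))
    exact ⟨n + n', by omega, h.trans h'⟩
  | @branch_true f p q v S t v' S' hf _ ih =>
    intro Λ M emb ex hM
    obtain ⟨n, hn, h⟩ := ih M (fun l => emb (some (Sum.inl l))) ex (fun l => hM (some (Sum.inl l)))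
    refine ⟨1 + n, by omega, Reaches.trans ?_ h⟩
    exact Reaches.single (hM none) (by simp only [compile, TM2.stepAux, hf, Bool.cond_true])
  | @branch_false f p q v S t v' S' hf _ ih =>
    intro Λ M emb ex hM
    obtain ⟨n, hn, h⟩ := ih M (fun l => emb (some (Sum.inr l))) ex (fun l => hM (some (Sum.inr l)))
    refine ⟨1 + n, by omega, Reaches.trans ?_ h⟩
    exact Reaches.single (hM none) (by simp only [compile, TM2.stepAux, hf, Bool.cond_false])
  | @loop_false f p v S hf =>
    intro Λ M emb ex hM
    refine ⟨1, le_rfl, ?_⟩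
    exact Reaches.single (hM none) (by simp only [compile, TM2.stepAux, hf, Bool.cond_false])
  | @loop_true f p v S t v' S' t' v'' S'' hf _ _ ih ih' =>
    intro Λ M emb ex hM
    obtain ⟨n, hn, h⟩ := ih M (fun l => emb (some l)) (emb none) (fun l => hM (some l))
    obtain ⟨n', hn', h'⟩ := ih' M emb ex hM
    refine ⟨1 + n + n', by omega, Reaches.trans (Reaches.trans ?_ h) h'⟩
    exact Reaches.single (hM none) (by simp only [compile, TM2.stepAux, hf, Bool.cond_true])
  | weaken _ hle ih =>
    intro Λ M emb ex hM
    obtain ⟨n, hn, h⟩ := ih M emb ex hM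
    exact ⟨n, hn.trans hle, h⟩

end StackProg

/-! ### Binary trees as data -/

/-- Binary trees, the universal data type. -/
inductive DTree : Type
  | nil
  | cons (a b : DTree)

/-- The prefix code of a tree. -/
def DTree.code : DTree → List Bool
  | nil => [false]
  | cons a b => true :: (a.code ++ b.code)

/-! ### Programs on four binary stacks and an input stack -/

namespace StackProg

/-- The names of the binary stacks. -/
inductive BStk : Type
  | main
  | tmp₁
  | tmp₂
  | cnt
  deriving DecidableEq

instance : Fintype BStk :=
  ⟨{.main, .tmp₁, .tmp₂, .cnt}, fun x => by cases x <;> simp⟩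

/-- The stack alphabets: `none` is the input stack. -/
abbrev Sym (I : Type) : Option BStk → Type
  | none => I
  | some _ => Bool

/-- Programs with a register for an input letter and a register for a bit. -/
abbrev BProg (I : Type) : Type := StackProg (Sym I) (Option I × Option Bool)

/-- The contents of the bit register and the binary stacks. -/
structure Mem : Type where
  reg : Option Bool
  main : List Bool
  tmp₁ : List Bool
  tmp₂ : List Bool
  cnt : List Bool

namespace Mem

/-- The contents of a binary stack. -/
def get : BStk → Mem → List Bool
  | .main, s => s.main
  | .tmp₁, s => s.tmp₁
  | .tmp₂, s => s.tmp₂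
  | .cnt, s => s.cnt

/-- Replacing the contents of a binary stack. -/
def set : BStk → List Bool → Mem → Mem
  | .main, l, s => { s with main := l }
  | .tmp₁, l, s => { s with tmp₁ := l }
  | .tmp₂, l, s => { s with tmp₂ := l }
  | .cnt, l, s => { s with cnt := l }

/-- All stacks, when the contents of the input stack is `w`. -/
def stk {I : Type} (w : List I) (s : Mem) : ∀ k, List (Sym I k)
  | none => w
  | some b => (s.get b : List Bool)

theorem stk_set {I : Type} (w : List I) (s : Mem) (b : BStk) (l : List Bool) (r : Option Bool) :
    stk w { s.set b l with reg := r } = Function.update (stk w s) (some b) l := by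
  funext k
  rcases k with _ | b'
  · rfl
  · by_cases h : b' = b
    · subst h
      rw [Function.update_self]
      cases b' <;> rfl
    · rw [Function.update_of_ne (by simpa using h)]
      cases b' <;> cases b <;> first | rfl | exact absurd rfl h

end Mem

variable {I : Type}

/-- `Exec p s t s'`: the program `p` leads from `s` to `s'` within `t` steps and does not touch the
input. -/
def Exec (p : BProg I) (s : Mem) (t : ℕ) (s' : Mem) : Prop :=
  ∀ i w, Run p (i, s.reg) (s.stk w) t (i, s'.reg) (s'.stk w)

/-- Push a bit that depends on the register. -/
def pushB (b : BStk) (f : Option Bool → Bool) : BProg I := .push (some b) (fun v => f v.2)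

/-- Pop a bit into the register. -/
def popB (b : BStk) : BProg I := .pop (some b) (fun v x => (v.1, x))

/-- Load the bit register. -/
def loadB (x : Option Bool) : BProg I := .load (fun v => (v.1, x))

/-- The empty program. -/
def skip : BProg I := .load id

/-- Branch on the bit register. -/
def condB (f : Option Bool → Bool) (p q : BProg I) : BProg I := .branch (fun v => f v.2) p q

/-- Loop while the bit register satisfies a condition. -/
def loopB (f : Option Bool → Bool) (p : BProg I) : BProg I := .loop (fun v => f v.2) p

namespace Exec

theorem push (b : BStk) (f : Option Bool → Bool) (s : Mem) :
    Exec (pushB b f : BProg I) s 1 (s.set b (f s.reg :: s.get b)) := by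
  intro i w
  have h := Mem.stk_set w s b (f s.reg :: s.get b) s.reg
  have h1 : ({ s.set b (f s.reg :: s.get b) with reg := s.reg } : Mem) =
    s.set b (f s.reg :: s.get b) := by cases b <;> rfl
  have h2 : (s.set b (f s.reg :: s.get b)).reg = s.reg := by cases b <;> rfl
  rw [h1] at h
  rw [h, h2]
  exact Run.push _ _ _ _

theorem pop (b : BStk) (s : Mem) :
    Exec (popB b : BProg I) s 1 { s.set b (s.get b).tail with reg := (s.get b).head? } := by
  intro i w
  rw [Mem.stk_set]
  exact Run.pop _ _ _ _

theorem load (x : Option Bool) (s : Mem) : Exec (loadB x : BProg I) s 1 { s with reg := x } := by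
  intro i w
  have h : Mem.stk w { s with reg := x } = Mem.stk w s := by
    funext k
    rcases k with _ | b
    · rfl
    · cases b <;> rfl
  rw [h]
  exact Run.load _ _ _

theorem skip (s : Mem) : Exec (skip : BProg I) s 1 s :=
  fun i w => Run.load (Γ := Sym I) id (i, s.reg) (s.stk w)

theorem weaken {p : BProg I} {s s' : Mem} {t t' : ℕ} (h : Exec p s t s') (ht : t ≤ t') :
    Exec p s t' s' :=
  fun i w => (h i w).weaken ht

theorem seq {p q : BProg I} {s s' s'' : Mem} {t t' : ℕ} (h : Exec p s t s')
    (h' : Exec q s' t' s'') : Exec (.seq p q) s (t + t') s'' :=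
  fun i w => (h i w).seq (h' i w)

theorem cond_true {f : Option Bool → Bool} {p q : BProg I} {s s' : Mem} {t : ℕ}
    (hf : f s.reg = true) (h : Exec p s t s') : Exec (condB f p q) s (t + 1) s' :=
  fun i w => .branch_true hf (h i w)

theorem cond_false {f : Option Bool → Bool} {p q : BProg I} {s s' : Mem} {t : ℕ}
    (hf : f s.reg = false) (h : Exec q s t s') : Exec (condB f p q) s (t + 1) s' :=
  fun i w => .branch_false hf (h i w)

theorem loop_false {f : Option Bool → Bool} {p : BProg I} {s : Mem}
    (hf : f s.reg = false) : Exec (loopB f p) s 1 s :=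
  fun _ _ => .loop_false hf

theorem loop_true {f : Option Bool → Bool} {p : BProg I} {s s' s'' : Mem} {t t' : ℕ}
    (hf : f s.reg = true) (h : Exec p s t s') (h' : Exec (loopB f p) s' t' s'') :
    Exec (loopB f p) s (t + t' + 1) s'' :=
  fun i w => .loop_true hf (h i w) (h' i w)

end Exec

/-! ### Moving trees -/

/-- Push the bit register onto the chosen temporary stacks. -/
def keep (b₁ b₂ : Bool) : BProg I :=
  .seq (bif b₁ then pushB .tmp₁ fun r => r.getD false else skip)
    (bif b₂ then pushB .tmp₂ fun r => r.getD false else skip)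

/-- The loop that takes a tree off the main stack. -/
def walkLoop (b₁ b₂ : Bool) : BProg I :=
  loopB Option.isSome (.seq (popB .main) (.seq (keep b₁ b₂)
    (condB (fun r => r.getD false) (pushB .cnt fun _ => true) (popB .cnt))))

/-- Take a tree off the main stack and put it, reversed, onto the chosen temporary stacks. -/
def walk (b₁ b₂ : Bool) : BProg I := .seq (loadB (some true)) (walkLoop b₁ b₂)

/-- The contents of a temporary stack after taking a tree with code `l` off the main stack. -/
def kept (b : Bool) (l t : List Bool) : List Bool := bif b then l.reverse ++ t else t

theorem exec_keep (b₁ b₂ x : Bool) (m t u c : List Bool) :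
    Exec (keep b₁ b₂ : BProg I) ⟨some x, m, t, u, c⟩ 2
      ⟨some x, m, kept b₁ [x] t, kept b₂ [x] u, c⟩ := by
  refine Exec.seq (t := 1) (t' := 1) (s' := ⟨some x, m, kept b₁ [x] t, u, c⟩) ?_ ?_
  · cases b₁
    · exact Exec.skip _
    · exact Exec.push .tmp₁ (fun r => r.getD false) ⟨some x, m, t, u, c⟩
  · cases b₂
    · exact Exec.skip _
    · exact Exec.push .tmp₂ (fun r => r.getD false) ⟨some x, m, _, u, c⟩

theorem kept_append (b : Bool) (l l' t : List Bool) :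
    kept b (l ++ l') t = kept b l' (kept b l t) := by
  cases b <;> simp [kept]

theorem exec_walkLoop_true {b₁ b₂ x : Bool} {m t u c : List Bool} {n : ℕ} {s' : Mem}
    (h : Exec (walkLoop b₁ b₂ : BProg I)
      ⟨some true, m, kept b₁ [true] t, kept b₂ [true] u, true :: c⟩ n s') :
    Exec (walkLoop b₁ b₂ : BProg I) ⟨some x, true :: m, t, u, c⟩ (n + 6) s' :=
  (Exec.loop_true rfl ((Exec.pop .main _).seq ((exec_keep b₁ b₂ true m t u c).seq
    (Exec.cond_true rfl (Exec.push _ _ _)))) h).weaken (by omega)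

theorem exec_walkLoop_false {b₁ b₂ x : Bool} {m t u c : List Bool} {n : ℕ} {s' : Mem}
    (h : Exec (walkLoop b₁ b₂ : BProg I)
      ⟨c.head?, m, kept b₁ [false] t, kept b₂ [false] u, c.tail⟩ n s') :
    Exec (walkLoop b₁ b₂ : BProg I) ⟨some x, false :: m, t, u, c⟩ (n + 6) s' :=
  (Exec.loop_true rfl ((Exec.pop .main _).seq ((exec_keep b₁ b₂ false m t u c).seq
    (Exec.cond_false rfl (Exec.pop .cnt _)))) h).weaken (by omega)

/-- The stack `cnt` holds one mark for each tree still expected after the current one. In a prefix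
code `true` replaces one expected tree by two, so a mark is added; `false` completes a tree, so a
mark is removed. With at least one mark present, the last leaf of `d` leaves `some true` in the
register and the loop goes on. As the loop does not stop at the end of `d`, the rest of its run
enters as a hypothesis. -/
theorem exec_walkLoop_subtree (b₁ b₂ : Bool) (d : DTree) :
    ∀ (m t u : List Bool) (k n : ℕ) (s' : Mem) (x : Bool),
      Exec (walkLoop b₁ b₂ : BProg I)
        ⟨some true, m, kept b₁ d.code t, kept b₂ d.code u, List.replicate k true⟩ n s' →
      Exec (walkLoop b₁ b₂ : BProg I)
        ⟨some x, d.code ++ m, t, u, List.replicate (k + 1) true⟩ (n + 6 * d.code.length) s' := by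
  induction d with
  | nil =>
    intro m t u k n s' x h
    exact exec_walkLoop_false h
  | cons a b iha ihb =>
    intro m t u k n s' x h
    rw [DTree.code, List.cons_append, List.append_assoc]
    have e : true :: (a.code ++ b.code) = [true] ++ (a.code ++ b.code) := rfl
    rw [DTree.code, e, kept_append, kept_append, kept_append, kept_append] at h
    refine (exec_walkLoop_true (iha _ _ _ (k + 1) _ s' true (ihb _ _ _ k n s' true h))).weaken ?_
    simp only [List.length_cons, List.length_append]
    omega

/-- Without marks, the last leaf pops the empty counter; the register becomes `none` and ends the
loop. In a pair, the first component is read with one mark, the second with none. -/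
theorem exec_walkLoop (b₁ b₂ : Bool) (d : DTree) :
    ∀ (m t u : List Bool) (x : Bool),
      Exec (walkLoop b₁ b₂ : BProg I) ⟨some x, d.code ++ m, t, u, []⟩ (6 * d.code.length + 1)
        ⟨none, m, kept b₁ d.code t, kept b₂ d.code u, []⟩ := by
  induction d with
  | nil =>
    intro m t u x
    exact exec_walkLoop_false (Exec.loop_false rfl)
  | cons a b iha ihb =>
    intro m t u x
    have e : true :: (a.code ++ b.code) = [true] ++ (a.code ++ b.code) := rfl
    rw [DTree.code, List.cons_append, List.append_assoc, e, kept_append, kept_append, kept_append,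
      kept_append]
    refine (exec_walkLoop_true
      (exec_walkLoop_subtree b₁ b₂ a _ _ _ 0 _ _ true (ihb _ _ _ _))).weaken ?_
    simp only [List.length_cons, List.length_append, List.length_nil]
    omega

theorem exec_walk (b₁ b₂ : Bool) (d : DTree) (r : Option Bool) (m t u : List Bool) :
    Exec (walk b₁ b₂ : BProg I) ⟨r, d.code ++ m, t, u, []⟩ (6 * d.code.length + 2)
      ⟨none, m, kept b₁ d.code t, kept b₂ d.code u, []⟩ :=
  ((Exec.load _ _).seq (exec_walkLoop b₁ b₂ d m t u true)).weaken (by omega)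

/-- The loop that moves a stack to the main stack, in reverse order. -/
def drainLoop (b : BStk) : BProg I :=
  loopB Option.isSome (.seq (pushB .main fun r => r.getD false) (popB b))

/-- Move a stack to the main stack, in reverse order. -/
def drain (b : BStk) : BProg I := .seq (popB b) (drainLoop b)

/-- The invariant holds after a pop: the top bit of the stack is in the register, so that an empty
stack shows up as `none`. -/
theorem exec_drainLoop₁ (l : List Bool) : ∀ (m u c : List Bool),
    Exec (drainLoop .tmp₁ : BProg I) ⟨l.head?, m, l.tail, u, c⟩ (3 * l.length + 1)
      ⟨none, l.reverse ++ m, [], u, c⟩ := by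
  induction l with
  | nil => exact fun _ _ _ => Exec.loop_false rfl
  | cons x l ih =>
    intro m u c
    rw [List.reverse_cons, List.append_assoc]
    refine (Exec.loop_true rfl ((Exec.push .main _ ⟨some x, m, l, u, c⟩).seq (Exec.pop .tmp₁ _))
      (ih (x :: m) u c)).weaken ?_
    simp only [List.length_cons]
    omega

theorem exec_drainLoop₂ (l : List Bool) : ∀ (m t c : List Bool),
    Exec (drainLoop .tmp₂ : BProg I) ⟨l.head?, m, t, l.tail, c⟩ (3 * l.length + 1)
      ⟨none, l.reverse ++ m, t, [], c⟩ := by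
  induction l with
  | nil => exact fun _ _ _ => Exec.loop_false rfl
  | cons x l ih =>
    intro m t c
    rw [List.reverse_cons, List.append_assoc]
    refine (Exec.loop_true rfl ((Exec.push .main _ ⟨some x, m, t, l, c⟩).seq (Exec.pop .tmp₂ _))
      (ih (x :: m) t c)).weaken ?_
    simp only [List.length_cons]
    omega

theorem exec_drain₁ (l : List Bool) (r : Option Bool) (m u c : List Bool) :
    Exec (drain .tmp₁ : BProg I) ⟨r, m, l.reverse, u, c⟩ (3 * l.length + 2)
      ⟨none, l ++ m, [], u, c⟩ := by
  have h := (Exec.pop .tmp₁ ⟨r, m, l.reverse, u, c⟩).seq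
    (exec_drainLoop₁ (I := I) l.reverse m u c)
  rw [List.reverse_reverse, List.length_reverse] at h
  exact h.weaken (by omega)

theorem exec_drain₂ (l : List Bool) (r : Option Bool) (m t c : List Bool) :
    Exec (drain .tmp₂ : BProg I) ⟨r, m, t, l.reverse, c⟩ (3 * l.length + 2)
      ⟨none, l ++ m, t, [], c⟩ := by
  have h := (Exec.pop .tmp₂ ⟨r, m, t, l.reverse, c⟩).seq
    (exec_drainLoop₂ (I := I) l.reverse m t c)
  rw [List.reverse_reverse, List.length_reverse] at h
  exact h.weaken (by omega)

/-- The memory with empty register and only the main stack in use. -/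
def Mem.ofMain (m : List Bool) : Mem := ⟨none, m, [], [], []⟩

open Mem

/-- Remove the tree on top of the main stack. -/
def drop : BProg I := walk false false

/-- Duplicate the tree on top of the main stack. -/
def dup : BProg I := .seq (walk true true) (.seq (drain .tmp₁) (drain .tmp₂))

/-- Exchange the two topmost trees on the main stack. -/
def swap : BProg I :=
  .seq (walk true false) (.seq (walk false true) (.seq (drain .tmp₁) (drain .tmp₂)))

theorem exec_drop (d : DTree) (m : List Bool) :
    Exec (drop : BProg I) (ofMain (d.code ++ m)) (6 * d.code.length + 2) (ofMain m) :=
  exec_walk false false d none m [] []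

theorem exec_dup (d : DTree) (m : List Bool) :
    Exec (dup : BProg I) (ofMain (d.code ++ m)) (12 * d.code.length + 6)
      (ofMain (d.code ++ (d.code ++ m))) := by
  have h := exec_walk (I := I) true true d none m [] []
  simp only [kept, Bool.cond_true, List.append_nil] at h
  exact (h.seq ((exec_drain₁ d.code _ m _ _).seq (exec_drain₂ d.code _ _ _ _))).weaken (by omega)

theorem exec_swap (d e : DTree) (m : List Bool) :
    Exec (swap : BProg I) (ofMain (d.code ++ (e.code ++ m)))
      (9 * d.code.length + 9 * e.code.length + 8) (ofMain (e.code ++ (d.code ++ m))) := by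
  have h := exec_walk (I := I) true false d none (e.code ++ m) [] []
  have h' := exec_walk (I := I) false true e none m d.code.reverse []
  simp only [kept, Bool.cond_true, Bool.cond_false, List.append_nil] at h h'
  exact (h.seq (h'.seq ((exec_drain₁ d.code _ m _ _).seq (exec_drain₂ e.code _ _ _ _)))).weaken
    (by omega)

end StackProg

/-! ### Polynomial time on encoded data -/

/-- An encoding of the elements of a type by trees. -/
class TreeEnc (α : Type) where
  enc : α → DTree

namespace TreeEnc

/-- The code word of an element. -/
def bits {α : Type} [TreeEnc α] (a : α) : List Bool := (enc a).code

/-- The size of an element. -/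
def size {α : Type} [TreeEnc α] (a : α) : ℕ := (bits a).length

/-- In all of the following encodings a value is the trivial tree or has the same tree as a pair of
simpler values. Thus the single case distinction `treeCases` serves booleans, options, lists and
numbers. -/
instance : TreeEnc Unit := ⟨fun _ => .nil⟩

instance : TreeEnc Bool := ⟨fun b => bif b then .cons .nil .nil else .nil⟩

instance {α β : Type} [TreeEnc α] [TreeEnc β] : TreeEnc (α × β) :=
  ⟨fun x => .cons (enc x.1) (enc x.2)⟩

instance {α : Type} [TreeEnc α] : TreeEnc (Option α) :=
  ⟨fun x => x.elim .nil fun a => .cons (enc a) .nil⟩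

instance {α : Type} [TreeEnc α] : TreeEnc (List α) :=
  ⟨fun l => l.foldr (fun a t => .cons (enc a) t) .nil⟩

/-- Unary, so that values of numbers are bounded by sizes and a number can serve as the list that
controls an iteration. -/
instance : TreeEnc ℕ := ⟨fun n => enc (List.replicate n ())⟩

/-! ### Sizes of encodings -/

variable {α β : Type} [TreeEnc α] [TreeEnc β]

theorem bits_prod (x : α × β) : bits x = true :: (bits x.1 ++ bits x.2) := rfl

theorem bits_cons (a : α) (l : List α) : bits (a :: l) = true :: (bits a ++ bits l) := rfl

theorem size_prod (x : α × β) : size x = size x.1 + size x.2 + 1 := by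
  simp [size, bits_prod]

theorem size_mk (a : α) (b : β) : size (a, b) = size a + size b + 1 := size_prod _

theorem size_nil : size ([] : List α) = 1 := rfl

theorem size_cons (a : α) (l : List α) : size (a :: l) = size a + size l + 1 := by
  simp [size, bits_cons]

theorem size_none : size (none : Option α) = 1 := rfl

theorem size_some (a : α) : size (some a) = size a + 2 := by
  change ((true :: (bits a ++ [false]) : List Bool)).length = _
  simp [size]

theorem size_bool_le (b : Bool) : size b ≤ 3 := by cases b <;> decide

theorem size_pos (a : α) : 0 < size a := by
  unfold size bits
  cases enc a <;> simp [DTree.code]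

theorem size_nat (n : ℕ) : size n = 2 * n + 1 := by
  induction n with
  | zero => rfl
  | succ n ih =>
    change size (() :: List.replicate n ()) = _
    rw [size_cons]
    change size () + size n + 1 = _
    rw [ih, show size () = 1 from rfl]
    omega

theorem length_le_size (l : List α) : l.length ≤ size l := by
  induction l with
  | nil => exact Nat.zero_le _
  | cons a l ih => rw [size_cons, List.length_cons]; omega

theorem size_append (l l' : List α) : size (l ++ l') + 1 = size l + size l' := by
  induction l with
  | nil => rw [size_nil, List.nil_append]; omega
  | cons a l ih => rw [List.cons_append, size_cons, size_cons]; omega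

end TreeEnc

open TreeEnc

theorem Polynomial.eval_nat_mono (q : Polynomial ℕ) {x y : ℕ} (h : x ≤ y) :
    q.eval x ≤ q.eval y := by
  rw [Polynomial.eval_eq_sum, Polynomial.eval_eq_sum]
  exact Finset.sum_le_sum fun i _ => Nat.mul_le_mul_left _ (Nat.pow_le_pow_left h i)

/-- `f` is computable in polynomial time on encoded data. The type `I` is that of the letters on the
input stack, which is not touched. -/
@[fun_prop]
def PolyTime {α β : Type} [TreeEnc α] [TreeEnc β] (f : α → β) : Prop :=
  ∀ I : Type, ∃ (p : StackProg.BProg I) (q : Polynomial ℕ), ∀ a,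
    size (f a) ≤ q.eval (size a) ∧
      ∀ m, p.Exec (.ofMain (bits a ++ m)) (q.eval (size a)) (.ofMain (bits (f a) ++ m))

namespace PolyTime

open StackProg StackProg.Mem

variable {α β γ δ : Type} [TreeEnc α] [TreeEnc β] [TreeEnc γ] [TreeEnc δ]

theorem size_le {f : α → β} (hf : PolyTime f) :
    ∃ q : Polynomial ℕ, ∀ a, size (f a) ≤ q.eval (size a) := by
  obtain ⟨_, q, h⟩ := hf Unit
  exact ⟨q, fun a => (h a).1⟩

/-- A function that only changes the type in which a tree is read needs no work. Constructors and
the passage between structures and tuples are of this kind. -/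
theorem of_enc_eq {f : α → β} (h : ∀ a, enc (f a) = enc a) : PolyTime f := by
  intro I
  refine ⟨skip, Polynomial.X + 1, fun a => ?_⟩
  have hb : bits (f a) = bits a := by rw [bits, h, bits]
  rw [size, hb, Polynomial.eval_add, Polynomial.eval_X, Polynomial.eval_one]
  exact ⟨Nat.le_succ _, fun m => (Exec.skip _).weaken (Nat.le_add_left _ _)⟩

@[fun_prop]
theorem id' : PolyTime (fun a : α => a) := of_enc_eq fun _ => rfl

-- This is where the size bound in `PolyTime` is needed: the time of `g` is polynomial in the size
-- of `f a`, which must itself be polynomial in the size of `a`.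
@[fun_prop]
theorem comp {g : β → γ} {f : α → β} (hg : PolyTime g) (hf : PolyTime f) :
    PolyTime (fun a => g (f a)) := by
  intro I
  obtain ⟨p, q, h⟩ := hf I
  obtain ⟨p', q', h'⟩ := hg I
  refine ⟨.seq p p', q + q'.comp q, fun a => ?_⟩
  have hq := q'.eval_nat_mono (h a).1
  rw [Polynomial.eval_add, Polynomial.eval_comp]
  exact ⟨((h' (f a)).1.trans hq).trans (Nat.le_add_left _ _), fun m =>
    ((h a).2 m).seq (((h' (f a)).2 m).weaken hq)⟩

theorem exec_popMain {I : Type} (b : Bool) (m : List Bool) :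
    Exec (.seq (popB .main) (loadB none) : BProg I) (ofMain (b :: m)) 2 (ofMain m) :=
  (Exec.pop .main _).seq (Exec.load none _)

/-- Push a word. -/
def pushWord {I : Type} : List Bool → BProg I
  | [] => skip
  | b :: l => .seq (pushWord l) (pushB .main fun _ => b)

theorem exec_pushWord {I : Type} (l m : List Bool) :
    Exec (pushWord l : BProg I) (ofMain m) (l.length + 1) (ofMain (l ++ m)) := by
  induction l with
  | nil => exact Exec.skip _
  | cons b l ih => exact ih.seq (Exec.push .main (fun _ => b) (ofMain (l ++ m)))

@[fun_prop]
theorem const (b : β) : PolyTime (fun _ : α => b) := by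
  intro I
  refine ⟨.seq drop (pushWord (bits b)), 6 * Polynomial.X + 2 + Polynomial.C (size b + 1), fun a => ?_⟩
  simp only [Polynomial.eval_add, Polynomial.eval_mul, Polynomial.eval_X, Polynomial.eval_C,
    Polynomial.eval_ofNat]
  exact ⟨by omega, fun m => (exec_drop (enc a) m).seq (exec_pushWord _ _)⟩

@[fun_prop]
theorem prodMk {f : α → β} {g : α → γ} (hf : PolyTime f) (hg : PolyTime g) :
    PolyTime (fun a => (f a, g a)) := by
  intro I
  obtain ⟨p, q, h⟩ := hf I
  obtain ⟨p', q', h'⟩ := hg I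
  -- The second component is computed first, since the code of the first has to end up on top; the
  -- final `true` makes a pair of them. The argument is duplicated (12) and swapped (9), and the
  -- value of `g` costs its computation and a swap (1 + 9).
  refine ⟨.seq dup (.seq p' (.seq swap (.seq p (pushB .main fun _ => true)))),
    21 * Polynomial.X + q + 10 * q' + 15, fun a => ?_⟩
  simp only [Polynomial.eval_add, Polynomial.eval_mul, Polynomial.eval_X, Polynomial.eval_ofNat]
  have h1 := (h a).1
  have h2 := (h' a).1
  constructor
  · rw [size_mk]; omega
  · intro m
    have e3 := exec_swap (I := I) (enc (g a)) (enc a) m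
    have e4 := ((h a).2 (bits (g a) ++ m)).seq (Exec.push .main (fun _ => true) _)
    have e := (exec_dup (enc a) m).seq (((h' a).2 (bits a ++ m)).seq (e3.seq e4))
    rw [bits_prod, List.cons_append, List.append_assoc]
    refine e.weaken ?_
    change 12 * size a + 6 + (_ + (9 * size (g a) + 9 * size a + 8 + _)) ≤ _
    omega

@[fun_prop]
theorem fst' : PolyTime (fun x : α × β => x.1) := by
  intro I
  refine ⟨.seq (.seq (popB .main) (loadB none)) (.seq swap drop), 24 * Polynomial.X + 12,
    fun x => ?_⟩
  simp only [Polynomial.eval_add, Polynomial.eval_mul, Polynomial.eval_X, Polynomial.eval_ofNat]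
  rw [size_prod]
  refine ⟨by omega, fun m => ?_⟩
  rw [bits_prod, List.cons_append, List.append_assoc]
  refine ((exec_popMain _ _).seq ((exec_swap (enc x.1) (enc x.2) m).seq
    (exec_drop _ _))).weaken ?_
  change 2 + (9 * size x.1 + 9 * size x.2 + 8 + (6 * size x.2 + 2)) ≤ _
  omega

@[fun_prop]
theorem snd' : PolyTime (fun x : α × β => x.2) := by
  intro I
  refine ⟨.seq (.seq (popB .main) (loadB none)) drop, 24 * Polynomial.X + 12, fun x => ?_⟩
  simp only [Polynomial.eval_add, Polynomial.eval_mul, Polynomial.eval_X, Polynomial.eval_ofNat]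
  rw [size_prod]
  refine ⟨by omega, fun m => ?_⟩
  rw [bits_prod, List.cons_append, List.append_assoc]
  refine ((exec_popMain _ _).seq (exec_drop (enc x.1) _)).weaken ?_
  change 2 + (6 * size x.1 + 2) ≤ _
  omega

@[fun_prop]
theorem fst {f : α → β × γ} (hf : PolyTime f) : PolyTime (fun a => (f a).1) := fst'.comp hf

@[fun_prop]
theorem snd {f : α → β × γ} (hf : PolyTime f) : PolyTime (fun a => (f a).2) := snd'.comp hf

/-- Case distinction on whether the encoding of the first component is the trivial tree. -/
theorem treeCases {ε : Type} [TreeEnc ε] {h : α × ε → δ} {f : ε → δ} {g : (β × γ) × ε → δ}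
    (hf : PolyTime f) (hg : PolyTime g)
    (H : ∀ a, (enc a = .nil ∧ ∀ e, h (a, e) = f e) ∨
      ∃ x : β × γ, enc a = enc x ∧ ∀ e, h (a, e) = g (x, e)) : PolyTime h := by
  intro I
  obtain ⟨p, q, hp⟩ := hf I
  obtain ⟨p', q', hp'⟩ := hg I
  -- The popped bits are the head of the pair `(a, e)` and the head of the code of `a`; the latter
  -- decides the case. If it is `true`, both are pushed back, since the code of `(x, e)` begins with
  -- them.
  refine ⟨.seq (.seq (popB .main) (loadB none)) (.seq (popB .main) (condB (fun r => r.getD false)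
    (.seq (loadB none) (.seq (pushWord [true, true]) p')) (.seq (loadB none) p))),
    q + q' + 10, ?_⟩
  rintro ⟨a, e⟩
  simp only [Polynomial.eval_add, Polynomial.eval_ofNat]
  rcases H a with ⟨h0, h1⟩ | ⟨x, h0, h1⟩
  · rw [h1]
    have hs : size e ≤ size (a, e) := by rw [size_mk]; omega
    have hq := q.eval_nat_mono hs
    refine ⟨((hp e).1.trans hq).trans (by omega), fun m => ?_⟩
    have e0 : bits a = [false] := by rw [bits, h0, DTree.code]
    rw [bits_prod, e0, List.cons_append]
    exact ((exec_popMain _ _).seq ((Exec.pop .main (ofMain (false :: (bits e ++ m)))).seq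
      (Exec.cond_false rfl ((Exec.load none _).seq ((hp e).2 m))))).weaken (by omega)
  · rw [h1]
    have e0 : bits a = bits x := by rw [bits, h0, bits]
    have hs : size (a, e) = size (x, e) := by rw [size_mk, size_mk, size, e0, ← size]
    rw [hs]
    refine ⟨(hp' (x, e)).1.trans (by omega), fun m => ?_⟩
    have h2 := (hp' (x, e)).2 m
    rw [bits_prod, bits_prod] at h2
    rw [bits_prod, e0, bits_prod, List.cons_append]
    have h3 := exec_pushWord (I := I) [true, true] (bits x.1 ++ bits x.2 ++ bits e ++ m)
    exact ((exec_popMain _ _).seq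
      ((Exec.pop .main (ofMain (true :: (bits x.1 ++ bits x.2) ++ bits e ++ m))).seq
      (Exec.cond_true rfl ((Exec.load none _).seq (h3.seq h2))))).weaken (by simp; omega)

/-- The loop that applies a program as often as a list is long. -/
def iterLoop {I : Type} (p : BProg I) : BProg I :=
  loopB (fun r => r.getD false) (.seq (loadB none) (.seq drop
    (.seq swap (.seq p (.seq swap (popB .main))))))

/-- At the head of the loop the first bit of the code of the remaining list is in the register:
`true` iff the list is nonempty. A round drops the first element, applies `p` below the list by
means of two swaps, and pops the next such bit. -/
theorem exec_iterLoop {I : Type} {f : γ → γ} {p : BProg I} {T B L : ℕ}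
    (hp : ∀ x, size x ≤ B → ∀ m,
      p.Exec (.ofMain (bits x ++ m)) T (.ofMain (bits (f x) ++ m)))
    (m : List Bool) (l : List α) : size l ≤ L → ∀ x : γ,
    (∀ i ≤ l.length, size (f^[i] x) ≤ B) →
    Exec (iterLoop p) ⟨(bits l ++ (bits x ++ m)).head?, (bits l ++ (bits x ++ m)).tail, [], [], []⟩
      (1 + l.length * (T + 24 * (L + B) + 24))
      ⟨some false, bits (f^[l.length] x) ++ m, [], [], []⟩ := by
  induction l with
  | nil =>
    intro _ x _
    exact (Exec.loop_false rfl).weaken (by simp)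
  | cons a l ih =>
    intro hL x hB
    rw [size_cons] at hL
    have h0 : size x ≤ B := hB 0 (Nat.zero_le _)
    have h1 : size (f x) ≤ B := hB 1 (by simp)
    have ih' := ih (by omega) (f x) fun i hi => by
      rw [← Function.iterate_succ_apply]
      exact hB _ (by simpa using hi)
    rw [List.length_cons, Function.iterate_succ_apply, bits_cons, List.cons_append,
      List.append_assoc]
    have e1 := exec_drop (I := I) (enc a) (bits l ++ (bits x ++ m))
    have e2 := exec_swap (I := I) (enc l) (enc x) m
    have e3 := hp x h0 (bits l ++ m)
    have e4 := exec_swap (I := I) (enc (f x)) (enc l) m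
    have e5 := Exec.pop (I := I) .main (ofMain (bits l ++ (bits (f x) ++ m)))
    refine (Exec.loop_true rfl ((Exec.load none _).seq (e1.seq (e2.seq (e3.seq (e4.seq e5)))))
      ih').weaken ?_
    change 1 + (6 * size a + 2 + (9 * size l + 9 * size x + 8 +
      (T + (9 * size (f x) + 9 * size l + 8 + 1)))) + _ + 1 ≤ _
    rw [Nat.add_mul l.length 1]
    omega

/-- The list is merely a counter. The bound on all intermediate values is essential: a step that
doubles the size is cheap, but its iterates grow exponentially. -/
theorem iterate' {f : γ → γ} (hf : PolyTime f)
    (hb : ∃ q : Polynomial ℕ, ∀ (l : List α) (x : γ), ∀ i ≤ l.length,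
      size (f^[i] x) ≤ q.eval (size (l, x))) :
    PolyTime (fun x : List α × γ => f^[x.1.length] x.2) := by
  intro I
  obtain ⟨p, q, hp⟩ := hf I
  obtain ⟨Q, hQ⟩ := hb
  refine ⟨.seq (.seq (popB .main) (loadB none))
    (.seq (popB .main) (.seq (iterLoop p) (loadB none))),
    Q + 5 + Polynomial.X * (q.comp Q + 24 * (Polynomial.X + Q) + 24), ?_⟩
  rintro ⟨l, x⟩
  simp only [Polynomial.eval_add, Polynomial.eval_mul, Polynomial.eval_X, Polynomial.eval_ofNat,
    Polynomial.eval_comp]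
  refine ⟨(hQ l x _ le_rfl).trans (by omega), fun m => ?_⟩
  have hl : size l ≤ size (l, x) := by rw [size_mk]; omega
  have h := exec_iterLoop (I := I) (f := f) (p := p) (fun y hy m =>
    ((hp y).2 m).weaken (q.eval_nat_mono hy)) m l hl x (hQ l x)
  rw [bits_prod, List.cons_append, List.append_assoc]
  refine ((exec_popMain _ _).seq ((Exec.pop .main _).seq (h.seq (Exec.load none _)))).weaken ?_
  have := Nat.mul_le_mul_right (q.eval (Q.eval (size (l, x))) +
    24 * (size (l, x) + Q.eval (size (l, x))) + 24) ((length_le_size l).trans hl)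
  omega

end PolyTime

/-! ### Languages decidable in polynomial time -/

namespace StackProg

open StackProg.Mem

variable {I : Type}

/-- Pop an input letter into the register. -/
def popI : BProg I := .pop none (fun v x => (x, v.2))

theorem run_popI (v : Option I × Option Bool) (w : List I) (s : Mem) :
    Run (popI : BProg I) v (s.stk w) 1 (w.head?, v.2) (s.stk w.tail) := by
  have h : s.stk w.tail = Function.update (s.stk w) none w.tail := by
    funext k
    rcases k with _ | b
    · rfl
    · rfl
  rw [h]
  exact Run.pop _ _ _ _

/-- The letter in the register is compared with each letter of a fixed list, and the matching code
is pushed as a constant word. -/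
theorem exists_pushLetter (code : I → List Bool) (ls : List I) :
    ∃ (p : BProg I) (N : ℕ), ∀ a ∈ ls, ∀ w m,
      Run p (some a, none) ((ofMain m).stk w) N (some a, none) ((ofMain (code a ++ m)).stk w) := by
  classical
  induction ls with
  | nil => exact ⟨skip, 0, fun a h => by simp at h⟩
  | cons b ls ih =>
    obtain ⟨p, N, h⟩ := ih
    refine ⟨.branch (fun v => decide (v.1 = some b)) (PolyTime.pushWord (code b)) p,
      N + (code b).length + 2, fun a ha w m => ?_⟩
    by_cases hab : a = b
    · subst hab
      exact (Run.branch_true (by simp) (PolyTime.exec_pushWord (code a) m (some a) w)).weaken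
        (by omega)
    · refine (Run.branch_false (by simp [hab]) (h a ?_ w m)).weaken (by omega)
      simpa [hab] using ha

/-- Letters are popped from the front of the input and put in front of the list read so far, so the
word arrives reversed. -/
theorem exists_readInput [Finite I] [TreeEnc I] :
    ∃ (p : BProg I) (N : ℕ), ∀ w : List I,
      Run p (none, none) ((ofMain []).stk w) (N * w.length + 3)
        (none, none) ((ofMain (bits w.reverse)).stk []) := by
  classical
  have := Fintype.ofFinite I
  obtain ⟨p, N, h⟩ := exists_pushLetter (I := I) bits Finset.univ.toList
  have key : ∀ (w v : List I),
      Run (.loop (fun v => v.1.isSome) (.seq p (.seq (pushB .main fun _ => true) popI)) : BProg I)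
        (w.head?, none) ((ofMain (bits v)).stk w.tail) ((N + 3) * w.length + 1)
        (none, none) ((ofMain (bits (w.reverse ++ v))).stk []) := by
    intro w
    induction w with
    | nil => exact fun v => Run.loop_false rfl
    | cons a w ih =>
      intro v
      rw [List.reverse_cons, List.append_assoc]
      refine (Run.loop_true rfl ((h a (by simp) w (bits v)).seq
        ((Exec.push .main (fun _ => true) (ofMain (bits a ++ bits v)) (some a) w).seq
          (run_popI _ _ _))) (ih (a :: v))).weaken ?_
      rw [List.length_cons, Nat.mul_succ]
      omega
  refine ⟨.seq (pushB .main fun _ => false) (.seq popI (.loop (fun v => v.1.isSome)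
    (.seq p (.seq (pushB .main fun _ => true) popI)))), N + 3, fun w => ?_⟩
  have hk := key w []
  rw [List.append_nil] at hk
  exact ((Exec.push .main (fun _ => false) (ofMain []) none w).seq
    ((run_popI _ _ _).seq hk)).weaken (by omega)

/-- Replace the code of a bit by that bit. -/
def output : BProg I :=
  .seq (popB .main) (condB (fun r => r.getD false)
    (.seq (popB .main) (.seq (popB .main) (.seq (pushB .main fun _ => true) (loadB none))))
    (.seq (pushB .main fun _ => false) (loadB none)))

theorem exec_output (b : Bool) :
    Exec (output : BProg I) (ofMain (bits b)) 6 (ofMain [b]) := by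
  cases b
  · exact ((Exec.pop .main (ofMain [false])).seq (Exec.cond_false rfl
      ((Exec.push .main (fun _ => false) _).seq (Exec.load none _)))).weaken (by omega)
  · exact ((Exec.pop .main (ofMain [true, false, false])).seq (Exec.cond_true rfl
      ((Exec.pop .main _).seq ((Exec.pop .main _).seq
      ((Exec.push .main (fun _ => true) _).seq (Exec.load none _)))))).weaken (by omega)

/-- The machine that runs a program. -/
noncomputable def machine [Fintype I] (p : BProg I) : FinTM2 :=
  letI := Fintype.ofFinite (Lab p)
  { K := Option BStk
    k₀ := none
    k₁ := some .main
    Γ := Sym I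
    Λ := Option (Lab p)
    main := some (start p)
    σ := Option I × Option Bool
    initialState := (none, none)
    Γk₀Fin := inferInstanceAs (Fintype I)
    m := fun l => l.elim .halt (compile p some none) }

/-- The exit label `none` carries `halt`, which is the one extra step. A proper final configuration
has the initial register and nothing on the stacks but the output, hence the shape of the hypothesis
on the run. -/
theorem machine_outputs [Fintype I] {p : BProg I} {w w' : List I} {b : Bool} {o : List Bool}
    {t t' : ℕ} (h : Run p (none, none) ((ofMain []).stk w) t (none, none) ((ofMain [b]).stk []))
    (hw : w' = w) (ho : o = [b]) (ht : t + 1 ≤ t') :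
    Nonempty (TM2OutputsInTime (machine p) w' (some o) t') := by
  subst w' o
  obtain ⟨n, hn, h⟩ := h.reaches (fun l => l.elim .halt (compile p some none)) some none
    (fun l => rfl)
  have h' := h.trans (Reaches.single (c := ⟨none, (none, none), (ofMain [b]).stk []⟩) rfl rfl)
  have e1 : initList (machine p) w = ⟨some (some (start p)), (none, none), (ofMain []).stk w⟩ := by
    unfold initList
    congr 1
    funext k
    rcases k with _ | k
    · rfl
    · cases k <;> rfl
  have e2 : haltList (machine p) [b] = ⟨none, (none, none), (ofMain [b]).stk []⟩ := by
    unfold haltList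
    congr 1
    funext k
    rcases k with _ | k
    · rfl
    · cases k <;> rfl
  have h'' : (flip bind (machine p).step)^[n + 1] (some (initList (machine p) w)) =
      some (haltList (machine p) [b]) := by
    rw [e1, e2]
    exact h'
  exact ⟨⟨⟨n + 1, h''⟩, (Nat.succ_le_succ hn).trans ht⟩⟩

end StackProg

-- Reading, computing and output are run in sequence; the reversal is that of `exists_readInput`.
-- Over a finite alphabet the size of a word is linear in its length, so a polynomial in the size is
-- one in the length.
open StackProg in
theorem PolyTime.mem_P {I : Type} [Finite I] [TreeEnc I] {f : List I → Bool} (hf : PolyTime f) :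
    {w : List I | f w.reverse = true} ∈ WeightedEpistemic.P I := by
  classical
  have := Fintype.ofFinite I
  obtain ⟨p, q, hp⟩ := hf I
  obtain ⟨r, N, hr⟩ := exists_readInput (I := I)
  obtain ⟨c, hc⟩ : ∃ c : ℕ, ∀ a : I, size a ≤ c :=
    ⟨∑ a, size a, fun a => Finset.single_le_sum (f := fun a => size a) (fun _ _ => Nat.zero_le _)
      (Finset.mem_univ a)⟩
  have hs : ∀ w : List I, size w ≤ (c + 1) * w.length + 1 := by
    intro w
    induction w with
    | nil => exact (size_nil (α := I)).le
    | cons a w ih =>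
      have := hc a
      rw [size_cons, List.length_cons, Nat.mul_succ]
      omega
  have key : ∀ w : List I, Run (.seq r (.seq p output)) (none, none) ((Mem.ofMain []).stk w)
      (N * w.length + 3 + (q.eval ((c + 1) * w.length + 1) + 6)) (none, none)
      ((Mem.ofMain [f w.reverse]).stk []) := by
    intro w
    have h1 := (hp w.reverse).2 [] none []
    rw [List.append_nil, List.append_nil] at h1
    have h2 := hs w.reverse
    rw [List.length_reverse] at h2
    exact (hr w).seq ((h1.weaken (q.eval_nat_mono h2)).seq (exec_output _ none []))
  refine ⟨⟨⟨machine (.seq r (.seq p output)), Equiv.refl I, Equiv.refl Bool⟩,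
    Polynomial.C N * Polynomial.X + 10 +
      q.comp (Polynomial.C (c + 1) * Polynomial.X + 1), fun w => Classical.choice ?_⟩⟩
  -- `P` decides membership by a classical instance, so the equation is proved for every instance.
  have e : ∀ _ : Decidable (w ∈ {w : List I | f w.reverse = true}),
      decide (w ∈ {w : List I | f w.reverse = true}) = f w.reverse := fun _ => by simp
  refine machine_outputs (key w) (List.map_id w) ?_ ?_
  · exact congrArg (fun b : Bool => [b]) (e _)
  · simp only [Polynomial.eval_add, Polynomial.eval_mul, Polynomial.eval_X, Polynomial.eval_C,
      Polynomial.eval_ofNat, Polynomial.eval_comp, Polynomial.eval_one]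
    omega

/-! ### A library of functions computable in polynomial time -/

namespace PolyTime

variable {α β γ δ ε : Type} [TreeEnc α] [TreeEnc β] [TreeEnc γ] [TreeEnc δ] [TreeEnc ε]

@[fun_prop]
theorem cond {c : α → Bool} {f g : α → β} (hc : PolyTime c) (hf : PolyTime f) (hg : PolyTime g) :
    PolyTime (fun a => bif c a then f a else g a) := by
  have h : PolyTime (fun x : Bool × α => bif x.1 then f x.2 else g x.2) := by
    refine treeCases (f := g) (g := fun x : (Unit × Unit) × α => f x.2) hg (by fun_prop) ?_
    rintro (_ | _)
    · exact Or.inl ⟨rfl, fun _ => rfl⟩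
    · exact Or.inr ⟨((), ()), rfl, fun _ => rfl⟩
  exact h.comp (hc.prodMk id')

@[fun_prop]
theorem and {f g : α → Bool} (hf : PolyTime f) (hg : PolyTime g) :
    PolyTime (fun a => f a && g a) := by
  have h : PolyTime (fun a => bif f a then g a else false) := by fun_prop
  convert! h using 2 with a
  cases f a <;> rfl

@[fun_prop]
theorem or {f g : α → Bool} (hf : PolyTime f) (hg : PolyTime g) :
    PolyTime (fun a => f a || g a) := by
  have h : PolyTime (fun a => bif f a then true else g a) := by fun_prop
  convert! h using 2 with a

@[fun_prop]
theorem not {f : α → Bool} (hf : PolyTime f) : PolyTime (fun a => !f a) := by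
  have h : PolyTime (fun a => bif f a then false else true) := by fun_prop
  convert! h using 2 with a

@[fun_prop]
theorem bool_beq {f g : α → Bool} (hf : PolyTime f) (hg : PolyTime g) :
    PolyTime (fun a => f a == g a) := by
  have h : PolyTime (fun a => bif f a then g a else !g a) := by fun_prop
  convert! h using 2 with a
  cases f a <;> cases g a <;> rfl

theorem list_cases {l : α → List β} {f : α → γ} {g : α → β → List β → γ} (hl : PolyTime l)
    (hf : PolyTime f) (hg : PolyTime fun p : α × β × List β => g p.1 p.2.1 p.2.2) :
    PolyTime (fun a => (l a).casesOn (motive := fun _ => γ) (f a) (g a)) := by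
  have h : PolyTime (fun x : List β × α =>
      x.1.casesOn (motive := fun _ => γ) (f x.2) (g x.2)) := by
    refine treeCases (f := f) (g := fun x : (β × List β) × α => g x.2 x.1.1 x.1.2) hf ?_ ?_
    · exact hg.comp (f := fun x : (β × List β) × α => (x.2, x.1.1, x.1.2)) (by fun_prop)
    · rintro (_ | ⟨b, l⟩)
      · exact Or.inl ⟨rfl, fun _ => rfl⟩
      · exact Or.inr ⟨(b, l), rfl, fun _ => rfl⟩
  exact h.comp (hl.prodMk id')

theorem option_elim {o : α → Option β} {f : α → γ} {g : α → β → γ} (ho : PolyTime o)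
    (hf : PolyTime f) (hg : PolyTime fun p : α × β => g p.1 p.2) :
    PolyTime (fun a => (o a).elim (f a) (g a)) := by
  have h : PolyTime (fun x : Option β × α => x.1.elim (f x.2) (g x.2)) := by
    refine treeCases (f := f) (g := fun x : (β × Unit) × α => g x.2 x.1.1) hf ?_ ?_
    · exact hg.comp (f := fun x : (β × Unit) × α => (x.2, x.1.1)) (by fun_prop)
    · rintro (_ | b)
      · exact Or.inl ⟨rfl, fun _ => rfl⟩
      · exact Or.inr ⟨(b, ()), rfl, fun _ => rfl⟩
  exact h.comp (ho.prodMk id')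

theorem nat_cases {n : α → ℕ} {f : α → γ} {g : α → ℕ → γ} (hn : PolyTime n)
    (hf : PolyTime f) (hg : PolyTime fun p : α × ℕ => g p.1 p.2) :
    PolyTime (fun a => (n a).casesOn (motive := fun _ => γ) (f a) (g a)) := by
  have h : PolyTime (fun x : ℕ × α => x.1.casesOn (motive := fun _ => γ) (f x.2) (g x.2)) := by
    refine treeCases (f := f) (g := fun x : (Unit × ℕ) × α => g x.2 x.1.2) hf ?_ ?_
    · exact hg.comp (f := fun x : (Unit × ℕ) × α => (x.2, x.1.2)) (by fun_prop)
    · rintro (_ | n)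
      · exact Or.inl ⟨rfl, fun _ => rfl⟩
      · exact Or.inr ⟨((), n), rfl, fun _ => rfl⟩
  exact h.comp (hn.prodMk id')

@[fun_prop]
theorem list_cons {f : α → β} {g : α → List β} (hf : PolyTime f) (hg : PolyTime g) :
    PolyTime (fun a => f a :: g a) :=
  (of_enc_eq (f := fun x : β × List β => x.1 :: x.2) fun _ => rfl).comp (hf.prodMk hg)

@[fun_prop]
theorem option_some {f : α → β} (hf : PolyTime f) : PolyTime (fun a => some (f a)) :=
  (of_enc_eq (f := fun x : β × Unit => some x.1) fun _ => rfl).comp (hf.prodMk (const ()))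

@[fun_prop]
theorem succ {f : α → ℕ} (hf : PolyTime f) : PolyTime (fun a => f a + 1) :=
  (of_enc_eq (f := fun x : Unit × ℕ => x.2 + 1) fun _ => rfl).comp ((const ()).prodMk hf)

@[fun_prop]
theorem pred {f : α → ℕ} (hf : PolyTime f) : PolyTime (fun a => (f a).pred) := by
  have h := nat_cases hf (const 0) (g := fun _ k => k) (by fun_prop)
  convert! h using 2 with a
  cases f a <;> rfl

@[fun_prop]
theorem list_tail {f : α → List β} (hf : PolyTime f) : PolyTime (fun a => (f a).tail) := by
  have h := list_cases hf (const []) (g := fun _ _ l => l) (by fun_prop)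
  convert! h using 2 with a
  cases f a <;> rfl

@[fun_prop]
theorem list_headD {f : α → List β} {g : α → β} (hf : PolyTime f) (hg : PolyTime g) :
    PolyTime (fun a => (f a).headD (g a)) := by
  have h := list_cases hf hg (g := fun _ b _ => b) (by fun_prop)
  convert! h using 2 with a
  cases f a <;> rfl

/-- The parameter `e` travels unchanged in the state of the iteration. -/
theorem iterate_of_size {f : γ → β → β} (hf : PolyTime fun p : γ × β => f p.1 p.2)
    (hb : ∃ q : Polynomial ℕ, ∀ e b n, size ((f e)^[n] b) ≤ q.eval (size e + size b + n))
    {n : α → ℕ} {e : α → γ} {b : α → β} (hn : PolyTime n) (he : PolyTime e) (hx : PolyTime b) :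
    PolyTime (fun a => (f (e a))^[n a] (b a)) := by
  obtain ⟨q, hq⟩ := hb
  let F : γ × β → γ × β := fun p => (p.1, f p.1 p.2)
  have hF : PolyTime F := by fun_prop
  have hiter : ∀ i p, F^[i] p = (p.1, (f p.1)^[i] p.2) := by
    intro i
    induction i with
    | zero => exact fun _ => rfl
    | succ i ih => exact fun p => ih (F p)
  have h := iterate' (α := Unit) hF ⟨Polynomial.X + q + 1, fun l p i hi => by
    have h1 := hq p.1 p.2 i
    have h2 := length_le_size l
    have h3 := q.eval_nat_mono (x := size p.1 + size p.2 + i) (y := size (l, p)) (by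
      rw [size_mk, size_prod]
      omega)
    rw [hiter, size_mk, Polynomial.eval_add, Polynomial.eval_add, Polynomial.eval_X,
      Polynomial.eval_one]
    have h4 : size p.1 ≤ size (l, p) := by rw [size_mk, size_prod]; omega
    omega⟩
  have hrep : PolyTime (fun a => List.replicate (n a) ()) :=
    (of_enc_eq (f := fun n => List.replicate n ()) fun _ => rfl).comp hn
  have h' := (h.comp (hrep.prodMk (he.prodMk hx))).snd
  simpa only [hiter, List.length_replicate] using h'

/-- The state of the iteration contains the list still to be processed; after `i` rounds the
accumulator is the fold over the first `i` elements. These prefixes are why the size bound is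
required for all lists. -/
theorem foldl_of_size {g : γ → β → α → β}
    (hg : PolyTime fun p : γ × β × α => g p.1 p.2.1 p.2.2)
    (hb : ∃ q : Polynomial ℕ, ∀ e b l, size (List.foldl (g e) b l) ≤
      q.eval (size e + size b + size l))
    {e : δ → γ} {b : δ → β} {l : δ → List α} (he : PolyTime e) (hx : PolyTime b)
    (hl : PolyTime l) : PolyTime (fun d => (l d).foldl (g (e d)) (b d)) := by
  obtain ⟨q, hq⟩ := hb
  let F : List α × γ × β → List α × γ × β := fun p =>
    p.1.casesOn p fun a l => (l, p.2.1, g p.2.1 p.2.2 a)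
  have hF : PolyTime F := by
    refine list_cases (by fun_prop) (by fun_prop) ?_
    exact PolyTime.prodMk (by fun_prop) (PolyTime.prodMk (by fun_prop)
      (hg.comp (f := fun x : (List α × γ × β) × α × List α => (x.1.2.1, x.1.2.2, x.2.1))
        (by fun_prop)))
  have hiter : ∀ i l e b, F^[i] (l, e, b) = (l.drop i, e, (l.take i).foldl (g e) b) := by
    intro i
    induction i with
    | zero => exact fun _ _ _ => rfl
    | succ i ih =>
      intro l e b
      rw [Function.iterate_succ_apply]
      cases l with
      | nil => exact (ih [] e b).trans (by simp)
      | cons a l => exact (ih l e (g e b a)).trans rfl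
  have htake : ∀ (l : List α) i, size (l.take i) + size (l.drop i) = size l + 1 := by
    intro l i
    rw [← size_append, List.take_append_drop]
  have h := iterate' (α := α) hF ⟨Polynomial.X + q + 2, fun l p i _ => by
    obtain ⟨l', e, b⟩ := p
    have h1 := hq e b (l'.take i)
    have h2 := htake l' i
    have h5 := size_pos (l'.drop i)
    have h6 := size_pos (l'.take i)
    have h3 := q.eval_nat_mono (x := size e + size b + size (l'.take i))
      (y := size (l, l', e, b)) (by
        rw [size_mk, size_mk, size_mk]
        omega)
    rw [hiter, size_mk, size_mk, Polynomial.eval_add, Polynomial.eval_add, Polynomial.eval_X,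
      Polynomial.eval_ofNat]
    have h4 : size l' + size e ≤ size (l, l', e, b) := by rw [size_mk, size_mk, size_mk]; omega
    omega⟩
  have h' := (h.comp (hl.prodMk (hl.prodMk (he.prodMk hx)))).snd.snd
  simpa only [hiter, List.take_length] using h'

/-- If a step adds an amount that does not depend on the accumulator, the growth over the whole fold
is at most the length of the list times a polynomial. -/
theorem foldl_of_size_add {g : γ → β → α → β}
    (hg : PolyTime fun p : γ × β × α => g p.1 p.2.1 p.2.2)
    (hb : ∃ q : Polynomial ℕ, ∀ e b a, size (g e b a) ≤ size b + q.eval (size e + size a))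
    {e : δ → γ} {b : δ → β} {l : δ → List α} (he : PolyTime e) (hx : PolyTime b)
    (hl : PolyTime l) : PolyTime (fun d => (l d).foldl (g (e d)) (b d)) := by
  obtain ⟨q, hq⟩ := hb
  refine foldl_of_size hg ⟨Polynomial.X + Polynomial.X * q, fun e b l => ?_⟩ he hx hl
  have key : ∀ N b, size e + size l ≤ N →
      size (l.foldl (g e) b) ≤ size b + l.length * q.eval N := by
    intro N
    induction l with
    | nil => exact fun b _ => Nat.le_add_right _ _
    | cons a l ih =>
      intro b hN
      rw [size_cons] at hN
      have h1 := ih (g e b a) (by omega)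
      have h2 := hq e b a
      have h3 := q.eval_nat_mono (x := size e + size a) (y := N) (by omega)
      rw [List.foldl_cons, List.length_cons, Nat.succ_mul]
      omega
  have h1 := key (size e + size b + size l) b (by omega)
  have h2 := Nat.mul_le_mul_right (q.eval (size e + size b + size l))
    ((length_le_size l).trans (Nat.le_add_left _ (size e + size b)))
  rw [Polynomial.eval_add, Polynomial.eval_mul, Polynomial.eval_X]
  omega

@[fun_prop]
theorem list_reverse {f : α → List β} (hf : PolyTime f) : PolyTime (fun a => (f a).reverse) := by
  have h := foldl_of_size_add (γ := Unit) (g := fun _ (acc : List β) (b : β) => b :: acc)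
    (by fun_prop) ⟨Polynomial.X + 1, fun e b a => by
      simp only [Polynomial.eval_add, Polynomial.eval_X, Polynomial.eval_one, size_cons]
      omega⟩ (const ()) (const []) hf
  simpa only [List.foldl_flip_cons_eq_append', List.append_nil] using h

@[fun_prop]
theorem list_map {f : α → β → γ} {l : α → List β} (hf : PolyTime fun p : α × β => f p.1 p.2)
    (hl : PolyTime l) : PolyTime (fun a => (l a).map (f a)) := by
  obtain ⟨q, hq⟩ := hf.size_le
  have h := foldl_of_size_add (g := fun e (acc : List γ) (b : β) => f e b :: acc)
    (PolyTime.list_cons (hf.comp (f := fun p : α × List γ × β => (p.1, p.2.2)) (by fun_prop))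
      (by fun_prop)) ⟨q.comp (Polynomial.X + 1) + 1, fun e b a => by
      have h1 : size (f e a) ≤ q.eval (size (e, a)) := hq (e, a)
      rw [size_mk] at h1
      simp only [Polynomial.eval_add, Polynomial.eval_X, Polynomial.eval_one, size_cons,
        Polynomial.eval_comp]
      omega⟩ id' (const []) hl
  have h' := list_reverse h
  have e : ∀ a (l : List β) (m : List γ),
      (l.foldl (fun (acc : List γ) (b : β) => f a b :: acc) m).reverse =
        m.reverse ++ l.map (f a) := by
    intro a l
    induction l with
    | nil => simp
    | cons b l _ => intro m; simp
  simpa only [e, List.reverse_nil, List.nil_append] using h'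

@[fun_prop]
theorem list_all {p : α → β → Bool} {l : α → List β} (hp : PolyTime fun x : α × β => p x.1 x.2)
    (hl : PolyTime l) : PolyTime (fun a => (l a).all (p a)) := by
  have h := foldl_of_size_add (g := fun e (acc : Bool) (b : β) => acc && p e b)
    (PolyTime.and (by fun_prop)
      (hp.comp (f := fun p : α × Bool × β => (p.1, p.2.2)) (by fun_prop)))
    ⟨3, fun e b a => by
      rw [Polynomial.eval_ofNat]
      exact (size_bool_le _).trans (Nat.le_add_left _ _)⟩ id' (const true) hl
  have e : ∀ a (l : List β) (m : Bool),
      l.foldl (fun (acc : Bool) (b : β) => acc && p a b) m = (m && l.all (p a)) := by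
    intro a l
    induction l with
    | nil => simp
    | cons b l ih => intro m; simp [ih, Bool.and_assoc]
  simpa only [e, Bool.true_and] using h

@[fun_prop]
theorem list_length {l : α → List β} (hl : PolyTime l) : PolyTime (fun a => (l a).length) := by
  have h := foldl_of_size_add (γ := Unit) (g := fun _ (acc : ℕ) (_ : β) => acc + 1)
    (by fun_prop) ⟨2, fun e b a => by
      rw [Polynomial.eval_ofNat, size_nat, size_nat]
      omega⟩ (const ()) (const 0) hl
  have e : ∀ (l : List β) (m : ℕ), l.foldl (fun acc _ => acc + 1) m = m + l.length := by
    intro l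
    induction l with
    | nil => simp
    | cons b l ih => intro m; simp [ih]; omega
  simpa only [e, Nat.zero_add] using h

theorem size_tail_le (l : List α) : size l.tail ≤ size l := by
  cases l with
  | nil => exact le_rfl
  | cons a l => rw [size_cons, List.tail_cons]; omega

@[fun_prop]
theorem list_drop {n : α → ℕ} {l : α → List β} (hn : PolyTime n) (hl : PolyTime l) :
    PolyTime (fun a => (l a).drop (n a)) := by
  have h := iterate_of_size (γ := Unit) (f := fun _ (l : List β) => l.tail) (by fun_prop)
    ⟨Polynomial.X, fun e b n => by
      have : ∀ (n : ℕ) (b : List β), size (List.tail^[n] b) ≤ size b := by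
        intro n
        induction n with
        | zero => exact fun b => le_rfl
        | succ n ih => exact fun b => (ih b.tail).trans (size_tail_le b)
      have : size ((fun l : List β => l.tail)^[n] b) ≤ size b := this n b
      rw [Polynomial.eval_X]
      omega⟩ hn (const ()) hl
  have e : ∀ (n : ℕ) (b : List β), List.tail^[n] b = b.drop n := by
    intro n
    induction n with
    | zero => exact fun b => rfl
    | succ n ih =>
      intro b
      rw [Function.iterate_succ_apply, ih]
      cases b <;> simp
  simpa only [e] using h

@[fun_prop]
theorem list_getD {l : α → List β} {n : α → ℕ} {d : α → β} (hl : PolyTime l) (hn : PolyTime n)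
    (hd : PolyTime d) : PolyTime (fun a => (l a).getD (n a) (d a)) := by
  have h := list_headD (list_drop hn hl) hd
  have e : ∀ (n : ℕ) (l : List β) (d : β), (l.drop n).headD d = l.getD n d := by
    intro n l d
    rw [List.headD_eq_head?_getD, List.head?_drop, List.getD_eq_getElem?_getD]
  simpa only [e] using h

@[fun_prop]
theorem list_range {n : α → ℕ} (hn : PolyTime n) : PolyTime (fun a => List.range (n a)) := by
  let F : Unit → ℕ × List ℕ → ℕ × List ℕ := fun _ s => (s.1 + 1, s.1 :: s.2)
  have e : ∀ (u : Unit) (n : ℕ) (s : ℕ × List ℕ), ((F u)^[n] s).1 = s.1 + n ∧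
      size ((F u)^[n] s).2 ≤ size s.2 + n * (2 * (s.1 + n) + 2) := by
    intro u n
    induction n with
    | zero => exact fun s => ⟨rfl, Nat.le_add_right _ _⟩
    | succ n ih =>
      intro s
      obtain ⟨h1, h2⟩ := ih (F u s)
      rw [Function.iterate_succ_apply]
      constructor
      · rw [h1]; simp only [F]; omega
      · have h3 : size (F u s).2 = 2 * s.1 + 1 + size s.2 + 1 := by
          simp only [F, size_cons, size_nat]
        have h4 : n * (2 * ((F u s).1 + n) + 2) = n * (2 * (s.1 + (n + 1)) + 2) := by
          simp only [F]
          congr 2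
          omega
        rw [h4] at h2
        rw [Nat.succ_mul]
        omega
  have e' : ∀ (u : Unit) (n : ℕ), (F u)^[n] (0, []) = (n, (List.range n).reverse) := by
    intro u n
    induction n with
    | zero => rfl
    | succ n ih =>
      rw [Function.iterate_succ_apply', ih, List.range_succ, List.reverse_append]
      rfl
  have h := iterate_of_size (γ := Unit) (f := F) (by fun_prop)
    ⟨2 * Polynomial.X + 2 + Polynomial.X * (2 * Polynomial.X + 2), fun u s n => by
      obtain ⟨h1, h2⟩ := e u n s
      have h6 : size s = size s.1 + size s.2 + 1 := size_prod s
      have h4 := size_nat s.1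
      rw [size_prod, size_nat, h1]
      simp only [Polynomial.eval_add, Polynomial.eval_mul, Polynomial.eval_X,
        Polynomial.eval_ofNat]
      have h5 : n * (2 * (s.1 + n) + 2) ≤
          (size u + size s + n) * (2 * (size u + size s + n) + 2) :=
        Nat.mul_le_mul (by omega) (by omega)
      omega⟩ hn (const ()) (const (0, []))
  simpa only [e', List.reverse_reverse] using list_reverse h.snd

@[fun_prop]
theorem nat_add {f g : α → ℕ} (hf : PolyTime f) (hg : PolyTime g) :
    PolyTime (fun a => f a + g a) := by
  have e : ∀ m n : ℕ, (fun k => k + 1)^[n] m = m + n := by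
    intro m n
    induction n with
    | zero => rfl
    | succ n ih => rw [Function.iterate_succ_apply', ih]; omega
  have h := iterate_of_size (γ := Unit) (f := fun _ (k : ℕ) => k + 1) (by fun_prop)
    ⟨2 * Polynomial.X, fun u b n => by
      rw [e, size_nat, size_nat, Polynomial.eval_mul, Polynomial.eval_X, Polynomial.eval_ofNat]
      omega⟩ hg (const ()) hf
  simpa only [e] using h

@[fun_prop]
theorem nat_mul {f g : α → ℕ} (hf : PolyTime f) (hg : PolyTime g) :
    PolyTime (fun a => f a * g a) := by
  have e : ∀ m n b : ℕ, (fun k => k + m)^[n] b = b + m * n := by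
    intro m n b
    induction n with
    | zero => rfl
    | succ n ih => rw [Function.iterate_succ_apply', ih, Nat.mul_succ]; omega
  have h := iterate_of_size (f := fun m (k : ℕ) => k + m) (by fun_prop)
    ⟨2 * Polynomial.X + 2 * Polynomial.X * Polynomial.X, fun m b n => by
      rw [e, size_nat, size_nat, size_nat, Polynomial.eval_add, Polynomial.eval_mul,
        Polynomial.eval_mul, Polynomial.eval_mul, Polynomial.eval_X, Polynomial.eval_ofNat]
      have : m * n ≤ (2 * m + 1 + (2 * b + 1) + n) * (2 * m + 1 + (2 * b + 1) + n) :=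
        Nat.mul_le_mul (by omega) (by omega)
      rw [Nat.mul_assoc]
      omega⟩ hg hf (const 0)
  simpa only [e, Nat.zero_add] using h

@[fun_prop]
theorem nat_sub {f g : α → ℕ} (hf : PolyTime f) (hg : PolyTime g) :
    PolyTime (fun a => f a - g a) := by
  have e : ∀ m n : ℕ, Nat.pred^[n] m = m - n := by
    intro m n
    induction n with
    | zero => rfl
    | succ n ih => rw [Function.iterate_succ_apply', ih, Nat.pred_eq_sub_one]; omega
  have h := iterate_of_size (γ := Unit) (f := fun _ (k : ℕ) => k.pred) (by fun_prop)
    ⟨2 * Polynomial.X, fun u b n => by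
      have e' := e b n
      change size (Nat.pred^[n] b) ≤ _
      rw [e', size_nat, size_nat, Polynomial.eval_mul, Polynomial.eval_X, Polynomial.eval_ofNat]
      omega⟩ hg (const ()) hf
  convert! h using 2 with a
  exact (e _ _).symm

@[fun_prop]
theorem nat_le {f g : α → ℕ} (hf : PolyTime f) (hg : PolyTime g) :
    PolyTime (fun a => decide (f a ≤ g a)) := by
  have h := nat_cases (nat_sub hf hg) (const true) (g := fun _ _ => false) (by fun_prop)
  convert! h using 2 with a
  rcases hk : f a - g a with _ | k
  · simp; omega
  · simp; omega

@[fun_prop]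
theorem nat_lt {f g : α → ℕ} (hf : PolyTime f) (hg : PolyTime g) :
    PolyTime (fun a => decide (f a < g a)) :=
  nat_le (succ hf) hg

@[fun_prop]
theorem nat_beq {f g : α → ℕ} (hf : PolyTime f) (hg : PolyTime g) :
    PolyTime (fun a => f a == g a) := by
  have h := and (nat_le hf hg) (nat_le hg hf)
  convert! h using 2 with a
  rw [Bool.eq_iff_iff]
  simp
  omega

@[fun_prop]
theorem bits_beq {f g : α → List Bool} (hf : PolyTime f) (hg : PolyTime g) :
    PolyTime (fun a => f a == g a) := by
  have h : PolyTime (fun a => (f a).length == (g a).length &&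
      (List.range (f a).length).all fun i => (f a).getD i false == (g a).getD i false) := by
    fun_prop
  convert! h using 2 with a
  rw [Bool.eq_iff_iff]
  simp only [beq_iff_eq, Bool.and_eq_true, List.all_eq_true, List.mem_range]
  constructor
  · intro h
    rw [h]
    exact ⟨rfl, fun _ _ => rfl⟩
  · rintro ⟨h1, h2⟩
    refine List.ext_getElem h1 fun i hi hi' => ?_
    have := h2 i hi
    rwa [List.getD_eq_getElem _ _ hi, List.getD_eq_getElem _ _ hi'] at this

@[fun_prop]
theorem list_isEmpty {f : α → List β} (hf : PolyTime f) : PolyTime (fun a => (f a).isEmpty) := by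
  have h := list_cases hf (const true) (g := fun _ _ _ => false) (by fun_prop)
  convert! h using 2 with a
  cases f a <;> rfl

@[fun_prop]
theorem list_take {n : α → ℕ} {l : α → List β} (hn : PolyTime n) (hl : PolyTime l) :
    PolyTime (fun a => (l a).take (n a)) := by
  have h : PolyTime (fun a => ((l a).reverse.drop ((l a).length - n a)).reverse) := by fun_prop
  convert! h using 2 with a
  rw [List.drop_reverse, List.reverse_reverse]
  rcases le_total (n a) (l a).length with h | h
  · rw [Nat.sub_sub_self h]
  · rw [Nat.sub_eq_zero_of_le h, Nat.sub_zero, List.take_length, List.take_of_length_le h]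

/-- The programs for the `f i` need not be uniform in `i`. Truncating the index at `n` leaves
finitely many of them, which are joined by `n` case distinctions. -/
theorem nat_finite_cases (n : ℕ) : ∀ f : ℕ → α → β, (∀ i, PolyTime (f i)) →
    PolyTime fun x : ℕ × α => f (min x.1 n) x.2 := by
  induction n with
  | zero =>
    intro f hf
    simp only [Nat.min_zero]
    exact (hf 0).comp (by fun_prop)
  | succ n ih =>
    intro f hf
    have h := nat_cases (n := fun x : ℕ × α => x.1) (f := fun x => f 0 x.2)
      (g := fun x k => f (min k n + 1) x.2) (by fun_prop) ((hf 0).comp (by fun_prop))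
      ((ih (fun i => f (i + 1)) fun i => hf (i + 1)).comp
        (f := fun x : (ℕ × α) × ℕ => (x.2, x.1.2)) (by fun_prop))
    convert! h using 2 with x
    rcases x with ⟨_ | k, x⟩
    · simp
    · simp

end PolyTime

/-- Types whose elements are encoded by their indices. -/
class FiniteEnc (A : Type) extends TreeEnc A where
  index : A → ℕ
  index_injective : Function.Injective index
  enc_eq : ∀ a, enc a = TreeEnc.enc (index a)
  bound : ∃ N, ∀ a, index a < N

/-- The elements of a finite type are encoded by their indices. -/
@[reducible] noncomputable def FiniteEnc.ofFinite (A : Type) [Finite A] : FiniteEnc A where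
  enc a := TreeEnc.enc (Finite.equivFin A a).val
  index a := (Finite.equivFin A a).val
  index_injective := Fin.val_injective.comp (Finite.equivFin A).injective
  enc_eq _ := rfl
  bound := ⟨_, fun a => (Finite.equivFin A a).isLt⟩

/-! ### Case distinctions over finite types -/

namespace PolyTime

variable {α β γ : Type} [TreeEnc α] [TreeEnc β] [TreeEnc γ]

/-- Case distinction on an element of a finite type. -/
theorem finite_cases {A : Type} [FiniteEnc A] {f : A → α → β} {g : α → A} (hg : PolyTime g)
    (hf : ∀ a, PolyTime (f a)) : PolyTime (fun x => f (g x) x) := by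
  classical
  obtain ⟨N, hN⟩ := FiniteEnc.bound (A := A)
  rcases isEmpty_or_nonempty α with hα | ⟨⟨x₀⟩⟩
  · exact fun I => ⟨StackProg.skip, 0, fun a => hα.elim a⟩
  have : Nonempty A := ⟨g x₀⟩
  have hinv := Function.leftInverse_invFun (FiniteEnc.index_injective (A := A))
  have h := nat_finite_cases N (fun i => f (Function.invFun FiniteEnc.index i)) fun i => hf _
  have h' := h.comp (f := fun x => (FiniteEnc.index (g x), x))
    (((of_enc_eq fun a => (FiniteEnc.enc_eq a).symm).comp hg).prodMk id')
  convert! h' using 2 with x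
  rw [min_eq_left (hN _).le, hinv]

theorem of_finite {A : Type} [FiniteEnc A] (f : A → β) : PolyTime f :=
  finite_cases (f := fun a _ => f a) id' fun _ => const _

end PolyTime

/-! ### Quantifiers over fixed lists, and folds from the right -/

namespace PolyTime

variable {α β γ δ : Type} [TreeEnc α] [TreeEnc β] [TreeEnc γ] [TreeEnc δ]

/-- The list belongs to the program and not to the input, so the quantifier is unrolled and its
range needs no encoding. This treats the agents of a fixed group. -/
theorem all_const {A : Type} {p : A → α → Bool} (hp : ∀ a, PolyTime (p a)) (L : List A) :
    PolyTime (fun x => L.all fun a => p a x) := by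
  induction L with
  | nil => exact const true
  | cons a L ih => exact and (hp a) ih

theorem any_const {A : Type} {p : A → α → Bool} (hp : ∀ a, PolyTime (p a)) (L : List A) :
    PolyTime (fun x => L.any fun a => p a x) := by
  induction L with
  | nil => exact const false
  | cons a L ih => exact or (hp a) ih

theorem foldr_of_size_add {g : γ → α → β → β}
    (hg : PolyTime fun p : γ × α × β => g p.1 p.2.1 p.2.2)
    (hb : ∃ q : Polynomial ℕ, ∀ e a b, size (g e a b) ≤ size b + q.eval (size e + size a))
    {e : δ → γ} {b : δ → β} {l : δ → List α} (he : PolyTime e) (hx : PolyTime b)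
    (hl : PolyTime l) : PolyTime (fun d => (l d).foldr (g (e d)) (b d)) := by
  have h := foldl_of_size_add (g := fun e b a => g e a b)
    (hg.comp (f := fun p : γ × β × α => (p.1, p.2.2, p.2.1)) (by fun_prop))
    (hb.imp fun q hq e b a => hq e a b) he hx (list_reverse hl)
  simpa only [List.foldl_reverse] using h

end PolyTime

theorem TreeEnc.size_map_bool_le {α : Type} (l : List α) (f : α → Bool) :
    size (l.map f) ≤ 4 * l.length + 1 := by
  induction l with
  | nil => exact le_rfl
  | cons a l ih =>
    have := size_bool_le (f a)
    rw [List.map_cons, size_cons, List.length_cons]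
    omega

theorem FiniteEnc.size_le (A : Type) [FiniteEnc A] : ∃ c, ∀ a : A, size a ≤ c := by
  obtain ⟨N, hN⟩ := FiniteEnc.bound (A := A)
  refine ⟨2 * N + 1, fun a => ?_⟩
  have h : size a = size (FiniteEnc.index a) := by
    rw [size, bits, FiniteEnc.enc_eq a, ← bits, ← size]
  rw [h, size_nat]
  have := hN a
  omega

namespace WeightedEpistemic

/-! ### Raw models -/

/-- A finite model given by lists of bits. -/
structure RawModel : Type where
  numStates : ℕ
  numAbilities : ℕ
  edge : List Bool
  cap : List Bool

namespace RawModel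

instance : TreeEnc RawModel :=
  ⟨fun r => enc (r.numStates, r.numAbilities, r.edge, r.cap)⟩

variable {α : Type} [TreeEnc α]

theorem polyTime_toProd :
    PolyTime (fun r : RawModel => (r.numStates, r.numAbilities, r.edge, r.cap)) :=
  .of_enc_eq fun _ => rfl

@[fun_prop]
theorem polyTime_numStates {f : α → RawModel} (hf : PolyTime f) :
    PolyTime (fun a => (f a).numStates) := (polyTime_toProd.comp hf).fst

@[fun_prop]
theorem polyTime_numAbilities {f : α → RawModel} (hf : PolyTime f) :
    PolyTime (fun a => (f a).numAbilities) := (polyTime_toProd.comp hf).snd.fst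

@[fun_prop]
theorem polyTime_edge {f : α → RawModel} (hf : PolyTime f) :
    PolyTime (fun a => (f a).edge) := (polyTime_toProd.comp hf).snd.snd.fst

@[fun_prop]
theorem polyTime_cap {f : α → RawModel} (hf : PolyTime f) :
    PolyTime (fun a => (f a).cap) := (polyTime_toProd.comp hf).snd.snd.snd

@[fun_prop]
theorem polyTime_mk {f g : α → ℕ} {h k : α → List Bool} (hf : PolyTime f) (hg : PolyTime g)
    (hh : PolyTime h) (hk : PolyTime k) :
    PolyTime (fun a => RawModel.mk (f a) (g a) (h a) (k a)) :=
  PolyTime.comp (g := fun p : ℕ × ℕ × List Bool × List Bool => RawModel.mk p.1 p.2.1 p.2.2.1 p.2.2.2)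
    (f := fun a => (f a, g a, h a, k a)) (.of_enc_eq fun _ => rfl) (by fun_prop)

theorem numStates_le_size (r : RawModel) : r.numStates ≤ size r := by
  have h : size r = size (r.numStates, r.numAbilities, r.edge, r.cap) := rfl
  rw [h, size_mk, size_nat]
  omega

/-- Whether the ability `i` belongs to `E(s, t)`. -/
def edgeBit (r : RawModel) (s t i : ℕ) : Bool :=
  r.edge.getD ((s * r.numStates + t) * r.numAbilities + i) false

@[fun_prop]
theorem polyTime_edgeBit {f : α → RawModel} {s t i : α → ℕ} (hf : PolyTime f) (hs : PolyTime s)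
    (ht : PolyTime t) (hi : PolyTime i) :
    PolyTime (fun a => (f a).edgeBit (s a) (t a) (i a)) := by
  unfold edgeBit
  fun_prop

/-- Whether `E` is symmetric and `E(s, t)` is full only for `s = t`. -/
def isSimilarity (r : RawModel) : Bool :=
  (List.range r.numStates).all fun s => (List.range r.numStates).all fun t =>
    (s == t || !(List.range r.numAbilities).all fun i => r.edgeBit s t i) &&
      (List.range r.numAbilities).all fun i => r.edgeBit s t i == r.edgeBit t s i

@[fun_prop]
theorem polyTime_isSimilarity {f : α → RawModel} (hf : PolyTime f) :
    PolyTime (fun a => (f a).isSimilarity) := by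
  unfold isSimilarity
  fun_prop

/-- The truth set of a formula with a box whose accessibility relation is `rel`. -/
def box (r : RawModel) (rel : ℕ → ℕ → Bool) (S : List Bool) : List Bool :=
  (List.range r.numStates).map fun s => (List.range r.numStates).all fun t =>
    !rel s t || S.getD t false

theorem polyTime_box {f : α → RawModel} {rel : α → ℕ → ℕ → Bool} {S : α → List Bool}
    (hf : PolyTime f) (hrel : PolyTime fun p : α × ℕ × ℕ => rel p.1 p.2.1 p.2.2)
    (hS : PolyTime S) : PolyTime (fun a => (f a).box (rel a) (S a)) := by
  unfold box
  have h : PolyTime fun p : (α × ℕ) × ℕ => rel p.1.1 p.1.2 p.2 :=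
    hrel.comp (f := fun p : (α × ℕ) × ℕ => (p.1.1, p.1.2, p.2)) (by fun_prop)
  fun_prop

theorem size_box_le (r : RawModel) (rel : ℕ → ℕ → Bool) (S : List Bool) :
    size (r.box rel S) ≤ 4 * r.numStates + 1 := by
  have := size_map_bool_le (List.range r.numStates) fun s =>
    (List.range r.numStates).all fun t => !rel s t || S.getD t false
  rwa [List.length_range] at this

/-- Negation of truth sets. -/
def compl (r : RawModel) (S : List Bool) : List Bool :=
  (List.range r.numStates).map fun s => !S.getD s false

/-- Implication of truth sets. -/
def imp (r : RawModel) (S T : List Bool) : List Bool :=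
  (List.range r.numStates).map fun s => !S.getD s false || T.getD s false

@[fun_prop]
theorem polyTime_compl {f : α → RawModel} {S : α → List Bool} (hf : PolyTime f)
    (hS : PolyTime S) : PolyTime (fun a => (f a).compl (S a)) := by
  unfold compl
  fun_prop

@[fun_prop]
theorem polyTime_imp {f : α → RawModel} {S T : α → List Bool} (hf : PolyTime f)
    (hS : PolyTime S) (hT : PolyTime T) : PolyTime (fun a => (f a).imp (S a) (T a)) := by
  unfold imp
  fun_prop

theorem size_compl_le (r : RawModel) (S : List Bool) :
    size (r.compl S) ≤ 4 * r.numStates + 1 := by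
  have := size_map_bool_le (List.range r.numStates) fun s => !S.getD s false
  rwa [List.length_range] at this

theorem size_imp_le (r : RawModel) (S T : List Bool) :
    size (r.imp S T) ≤ 4 * r.numStates + 1 := by
  have := size_map_bool_le (List.range r.numStates) fun s => !S.getD s false || T.getD s false
  rwa [List.length_range] at this

/-- The truth set of common knowledge, for the relation `rel` of everyone's knowledge: the fixpoint
is reached after as many steps as there are states. -/
def common (r : RawModel) (rel : ℕ → ℕ → Bool) (S : List Bool) : List Bool :=
  (fun T => r.box rel (r.compl (r.imp S (r.compl T))))^[r.numStates]
    (r.box (fun _ _ => false) [])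

/-- Iterates do not grow: from the first round on, each is the value of a box, a list of `numStates`
bits. -/
theorem polyTime_common {f : α → RawModel} {rel : α → ℕ → ℕ → Bool} {S : α → List Bool}
    (hf : PolyTime f) (hrel : PolyTime fun p : α × ℕ × ℕ => rel p.1 p.2.1 p.2.2)
    (hS : PolyTime S) : PolyTime (fun a => (f a).common (rel a) (S a)) := by
  unfold common
  obtain ⟨q, hq⟩ := hf.size_le
  refine PolyTime.iterate_of_size
    (f := fun a T => (f a).box (rel a) ((f a).compl ((f a).imp (S a) ((f a).compl T))))
    (polyTime_box (by fun_prop)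
      (hrel.comp (f := fun p : (α × List Bool) × ℕ × ℕ => (p.1.1, p.2)) (by fun_prop))
      (by fun_prop))
    ⟨Polynomial.X + 4 * q + 1, fun a T n => ?_⟩ (by fun_prop) .id'
    (polyTime_box hf (.const false) (.const []))
  simp only [Polynomial.eval_add, Polynomial.eval_mul, Polynomial.eval_X, Polynomial.eval_ofNat,
    Polynomial.eval_one]
  have h1 := (hq a).trans (q.eval_nat_mono (x := size a) (y := size a + size T + n) (by omega))
  have h2 := (f a).numStates_le_size
  cases n with
  | zero =>
    simp only [Function.iterate_zero, id_eq]
    omega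
  | succ n =>
    rw [Function.iterate_succ_apply']
    refine (size_box_le _ _ _).trans ?_
    omega

theorem size_common_le (r : RawModel) (rel : ℕ → ℕ → Bool) (S : List Bool) :
    size (r.common rel S) ≤ 4 * r.numStates + 1 := by
  have h : ∀ n, size ((fun T => r.box rel (r.compl (r.imp S (r.compl T))))^[n]
      (r.box (fun _ _ => false) [])) ≤ 4 * r.numStates + 1 := by
    intro n
    cases n with
    | zero => exact size_box_le _ _ _
    | succ n =>
      rw [Function.iterate_succ_apply']
      exact size_box_le _ _ _
  exact h _

/-! ### Accessibility relations of agents and groups -/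

section Agents

variable {Ag : Type} [Fintype Ag] [LinearOrder Ag]

/-- The position of an agent in the list of all agents. -/
def agentIndex (a : Ag) : ℕ := ((Finset.univ : Finset Ag).sort (· ≤ ·)).idxOf a

/-- Whether the ability `i` belongs to `C(a)`. -/
def capBit (r : RawModel) (a : Ag) (i : ℕ) : Bool :=
  r.cap.getD (agentIndex a * r.numAbilities + i) false

@[fun_prop]
theorem polyTime_capBit (a : Ag) {f : α → RawModel} {i : α → ℕ} (hf : PolyTime f)
    (hi : PolyTime i) : PolyTime (fun x => (f x).capBit a (i x)) := by
  unfold capBit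
  fun_prop

/-- The accessibility relation of an agent. -/
def relAgent (r : RawModel) (a : Ag) (s t : ℕ) : Bool :=
  (List.range r.numAbilities).all fun i => !r.capBit a i || r.edgeBit s t i

@[fun_prop]
theorem polyTime_relAgent (a : Ag) {f : α → RawModel} {s t : α → ℕ} (hf : PolyTime f)
    (hs : PolyTime s) (ht : PolyTime t) : PolyTime (fun x => (f x).relAgent a (s x) (t x)) := by
  unfold relAgent
  fun_prop

/-- The accessibility relation of everyone's knowledge. -/
def relE (r : RawModel) (G : Finset Ag) (s t : ℕ) : Bool :=
  (G.sort (· ≤ ·)).any fun a => r.relAgent a s t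

/-- The accessibility relation of distributed knowledge. -/
def relD (r : RawModel) (G : Finset Ag) (s t : ℕ) : Bool :=
  (G.sort (· ≤ ·)).all fun a => r.relAgent a s t

/-- The accessibility relation of mutual knowledge. -/
def relM (r : RawModel) (G : Finset Ag) (s t : ℕ) : Bool :=
  (List.range r.numAbilities).all fun i =>
    !((G.sort (· ≤ ·)).all fun a => r.capBit a i) || r.edgeBit s t i

@[fun_prop]
theorem polyTime_relE (G : Finset Ag) {f : α → RawModel} {s t : α → ℕ} (hf : PolyTime f)
    (hs : PolyTime s) (ht : PolyTime t) : PolyTime (fun x => (f x).relE G (s x) (t x)) :=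
  PolyTime.any_const (p := fun a x => (f x).relAgent a (s x) (t x)) (fun a => by fun_prop) _

@[fun_prop]
theorem polyTime_relD (G : Finset Ag) {f : α → RawModel} {s t : α → ℕ} (hf : PolyTime f)
    (hs : PolyTime s) (ht : PolyTime t) : PolyTime (fun x => (f x).relD G (s x) (t x)) :=
  PolyTime.all_const (p := fun a x => (f x).relAgent a (s x) (t x)) (fun a => by fun_prop) _

@[fun_prop]
theorem polyTime_relM (G : Finset Ag) {f : α → RawModel} {s t : α → ℕ} (hf : PolyTime f)
    (hs : PolyTime s) (ht : PolyTime t) : PolyTime (fun x => (f x).relM G (s x) (t x)) := by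
  unfold relM
  have h : PolyTime fun p : α × ℕ => (G.sort (· ≤ ·)).all fun a => (f p.1).capBit a p.2 :=
    PolyTime.all_const (p := fun a (p : α × ℕ) => (f p.1).capBit a p.2) (fun a => by fun_prop) _
  fun_prop

end Agents

end RawModel

/-! ### Evaluation of formulas from right to left -/

/-- The state of the evaluation of a formula from right to left: the pending digits of the index of
a variable, the pending group, the remaining bits of the valuation in reverse order, the occurrences
of variables found so far, and the stack of truth sets. -/
structure EvalState (Ag : Type) : Type where
  name : List Bool
  group : Finset Ag
  rest : List Bool
  occ : List (List Bool × List Bool)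
  stack : List (List Bool)

section

variable {Ag : Type} [Fintype Ag] [LinearOrder Ag]

instance : Finite (Letter Ag) := by
  let f : Letter Ag → Ag ⊕ Bool ⊕ Fin 8
    | .agent a => .inl a
    | .bit b => .inr (.inl b)
    | .var => .inr (.inr 0)
    | .neg => .inr (.inr 1)
    | .imp => .inr (.inr 2)
    | .knows => .inr (.inr 3)
    | .commonK => .inr (.inr 4)
    | .distributedK => .inr (.inr 5)
    | .mutualK => .inr (.inr 6)
    | .sep => .inr (.inr 7)
  refine Finite.of_injective f fun x y h => ?_
  cases x <;> cases y <;> simp_all [f]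

noncomputable instance : FiniteEnc (Letter Ag) := .ofFinite _

/-- The set of agents is fixed, so there are finitely many groups: a pending group has bounded size,
and any function of it is a finite case distinction. -/
noncomputable instance : FiniteEnc (Finset Ag) := .ofFinite _

/-! ### Encoding of evaluation states -/

namespace EvalState

noncomputable instance : TreeEnc (EvalState Ag) :=
  ⟨fun s => enc (s.name, s.group, s.rest, s.occ, s.stack)⟩

theorem size_eq (s : EvalState Ag) :
    size s = size s.name + size s.group + size s.rest + size s.occ + size s.stack + 4 := by
  have h : size s = size (s.name, s.group, s.rest, s.occ, s.stack) := rfl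
  rw [h, size_mk, size_mk, size_mk, size_mk]
  omega

variable {α : Type} [TreeEnc α]

theorem polyTime_toProd :
    PolyTime (fun s : EvalState Ag => (s.name, s.group, s.rest, s.occ, s.stack)) :=
  .of_enc_eq fun _ => rfl

@[fun_prop]
theorem polyTime_name {f : α → EvalState Ag} (hf : PolyTime f) :
    PolyTime (fun a => (f a).name) := (polyTime_toProd.comp hf).fst

@[fun_prop]
theorem polyTime_group {f : α → EvalState Ag} (hf : PolyTime f) :
    PolyTime (fun a => (f a).group) := (polyTime_toProd.comp hf).snd.fst

@[fun_prop]
theorem polyTime_rest {f : α → EvalState Ag} (hf : PolyTime f) :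
    PolyTime (fun a => (f a).rest) := (polyTime_toProd.comp hf).snd.snd.fst

@[fun_prop]
theorem polyTime_occ {f : α → EvalState Ag} (hf : PolyTime f) :
    PolyTime (fun a => (f a).occ) := (polyTime_toProd.comp hf).snd.snd.snd.fst

@[fun_prop]
theorem polyTime_stack {f : α → EvalState Ag} (hf : PolyTime f) :
    PolyTime (fun a => (f a).stack) := (polyTime_toProd.comp hf).snd.snd.snd.snd

@[fun_prop]
theorem polyTime_mk {f₁ : α → List Bool} {f₂ : α → Finset Ag} {f₃ : α → List Bool}
    {f₄ : α → List (List Bool × List Bool)} {f₅ : α → List (List Bool)} (h₁ : PolyTime f₁)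
    (h₂ : PolyTime f₂) (h₃ : PolyTime f₃) (h₄ : PolyTime f₄) (h₅ : PolyTime f₅) :
    PolyTime (fun a => EvalState.mk (f₁ a) (f₂ a) (f₃ a) (f₄ a) (f₅ a)) :=
  PolyTime.comp (g := fun p : List Bool × Finset Ag × List Bool × List (List Bool × List Bool) ×
      List (List Bool) => EvalState.mk p.1 p.2.1 p.2.2.1 p.2.2.2.1 p.2.2.2.2)
    (f := fun a => (f₁ a, f₂ a, f₃ a, f₄ a, f₅ a)) (.of_enc_eq fun _ => rfl) (by fun_prop)

end EvalState

/-- Whether a list of digits is the binary representation of a number. -/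
def isNumeral (l : List Bool) : Bool := l.reverse.headD true

open Classical in
/-- The truth set of a formula that begins with a modality of the kind given by a letter, with a
pending group; the modality has to belong to the language. -/
noncomputable def modal (X : Set GroupOp) (r : RawModel) (S : List Bool) (G : Finset Ag) :
    Letter Ag → Option (List Bool)
  | .knows => bif decide (G.card = 1) then some (r.box (r.relD G) S) else none
  | .commonK => bif decide (G.Nonempty ∧ GroupOp.C ∈ X) then some (r.common (r.relE G) S) else none
  | .distributedK =>
      bif decide (G.Nonempty ∧ GroupOp.D ∈ X) then some (r.box (r.relD G) S) else none
  | .mutualK => bif decide (G.Nonempty ∧ GroupOp.M ∈ X) then some (r.box (r.relM G) S) else none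
  | _ => none

/-- The effect of a letter on the state of the evaluation. -/
noncomputable def evalStep (X : Set GroupOp) (r : RawModel) (st : EvalState Ag) :
    Letter Ag → Option (EvalState Ag)
  | .agent a =>
      bif st.name.isEmpty && decide (∀ b ∈ st.group, a < b) then
        some ⟨st.name, insert a st.group, st.rest, st.occ, st.stack⟩ else none
  | .bit b =>
      bif decide (st.group = ∅) then
        some ⟨b :: st.name, st.group, st.rest, st.occ, st.stack⟩ else none
  | .var =>
      bif decide (st.group = ∅) && isNumeral st.name && decide (r.numStates ≤ st.rest.length) then
        some ⟨[], ∅, st.rest.drop r.numStates,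
          (st.name, (st.rest.take r.numStates).reverse) :: st.occ,
          (st.rest.take r.numStates).reverse :: st.stack⟩ else none
  | .neg =>
      bif st.name.isEmpty && decide (st.group = ∅) && decide (1 ≤ st.stack.length) then
        some ⟨[], ∅, st.rest, st.occ, r.compl (st.stack.headD []) :: st.stack.tail⟩ else none
  | .imp =>
      bif st.name.isEmpty && decide (st.group = ∅) && decide (2 ≤ st.stack.length) then
        some ⟨[], ∅, st.rest, st.occ,
          r.imp (st.stack.headD []) (st.stack.tail.headD []) :: st.stack.tail.tail⟩ else none
  | .sep => none
  | l =>
      bif st.name.isEmpty && decide (1 ≤ st.stack.length) then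
        (modal X r (st.stack.headD []) st.group l).elim none fun S =>
          some ⟨[], ∅, st.rest, st.occ, S :: st.stack.tail⟩ else none

/-- Once the group is fixed by a finite case distinction, its accessibility relations are given by
fixed programs and the tests on the group and on `X` are constants. -/
theorem polyTime_modal (X : Set GroupOp) (l : Letter Ag) {α : Type} [TreeEnc α]
    {r : α → RawModel} {S : α → List Bool} {G : α → Finset Ag}
    (hr : PolyTime r) (hS : PolyTime S) (hG : PolyTime G) :
    PolyTime (fun a => modal X (r a) (S a) (G a) l) := by
  refine PolyTime.finite_cases (f := fun G a => modal X (r a) (S a) G l) hG fun G => ?_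
  have h1 := RawModel.polyTime_box (rel := fun a => (r a).relD G) hr (by fun_prop) hS
  have h2 := RawModel.polyTime_box (rel := fun a => (r a).relM G) hr (by fun_prop) hS
  have h3 := RawModel.polyTime_common (rel := fun a => (r a).relE G) hr (by fun_prop) hS
  cases l <;> simp only [modal] <;> fun_prop

@[fun_prop]
theorem polyTime_isNumeral {α : Type} [TreeEnc α] {f : α → List Bool} (hf : PolyTime f) :
    PolyTime (fun a => isNumeral (f a)) := by
  unfold isNumeral
  fun_prop

theorem polyTime_evalStep (X : Set GroupOp) {α : Type} [TreeEnc α]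
    {r : α → RawModel} {st : α → EvalState Ag} {l : α → Letter Ag}
    (hr : PolyTime r) (hst : PolyTime st) (hl : PolyTime l) :
    PolyTime (fun a => evalStep X (r a) (st a) (l a)) := by
  refine PolyTime.finite_cases (f := fun l a => evalStep X (r a) (st a) l) hl fun l => ?_
  have h0 : PolyTime fun a => decide ((st a).group = ∅) :=
    (PolyTime.of_finite fun G : Finset Ag => decide (G = ∅)).comp (by fun_prop)
  have h1 : ∀ c, PolyTime fun a => decide (∀ b ∈ (st a).group, c < b) := fun c =>
    (PolyTime.of_finite fun G : Finset Ag => decide (∀ b ∈ G, c < b)).comp (by fun_prop)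
  have h2 : ∀ c, PolyTime fun a => insert c (st a).group := fun c =>
    (PolyTime.of_finite fun G : Finset Ag => insert c G).comp (by fun_prop)
  have h3 : ∀ l, PolyTime fun a => bif (st a).name.isEmpty && decide (1 ≤ (st a).stack.length) then
        (modal X (r a) ((st a).stack.headD []) (st a).group l).elim none fun S =>
          some (⟨[], ∅, (st a).rest, (st a).occ, S :: (st a).stack.tail⟩ : EvalState Ag)
        else none := fun l => by
    have := PolyTime.option_elim (polyTime_modal X l hr (S := fun a => (st a).stack.headD [])
      (G := fun a => (st a).group) (by fun_prop) (by fun_prop)) (f := fun _ => none)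
      (g := fun a S => some (⟨[], ∅, (st a).rest, (st a).occ, S :: (st a).stack.tail⟩ :
        EvalState Ag)) (by fun_prop) (by fun_prop)
    fun_prop
  cases l <;> simp only [evalStep] <;> first | exact h3 _ | fun_prop

theorem size_modal_le (X : Set GroupOp) (r : RawModel) (S : List Bool) (G : Finset Ag)
    (l : Letter Ag) : ∀ T ∈ modal X r S G l, size T ≤ 4 * r.numStates + 1 := by
  have hif : ∀ (b : Bool) (T U : List Bool), T ∈ (bif b then some U else none) → T = U := by
    rintro (_ | _) T U h
    · simp at h
    · simpa using h.symm
  intro T hT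
  cases l with
  | knows => rw [hif _ _ _ hT]; exact RawModel.size_box_le _ _ _
  | commonK => rw [hif _ _ _ hT]; exact RawModel.size_common_le _ _ _
  | distributedK => rw [hif _ _ _ hT]; exact RawModel.size_box_le _ _ _
  | mutualK => rw [hif _ _ _ hT]; exact RawModel.size_box_le _ _ _
  | _ => simp [modal] at hT

/-- A letter adds at most a digit, an agent or some truth sets. The factor 8 is due to `var`, which
stores the truth set twice, each time with size at most `4 * r.numStates + 1`; the index is moved
and not copied. The constant `c` bounds the groups. -/
theorem size_evalStep_le (X : Set GroupOp) : ∃ c : ℕ, ∀ (r : RawModel) (st st' : EvalState Ag)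
    (l : Letter Ag), evalStep X r st l = some st' →
      size st' ≤ size st + (8 * size r + c) := by
  obtain ⟨c, hc⟩ := FiniteEnc.size_le (Finset Ag)
  refine ⟨c + 20, fun r st st' l h => ?_⟩
  have hif : ∀ (b : Bool) (U : EvalState Ag), (bif b then some U else none) = some st' →
      st' = U ∧ b = true := by
    rintro (_ | _) U h
    · simp at h
    · simpa using h.symm
  have hn := r.numStates_le_size
  have htl : ∀ l : List (List Bool), size l.tail ≤ size l := PolyTime.size_tail_le
  have p1 := size_pos st.name
  have p2 := size_pos st.group
  have htake : size (st.rest.take r.numStates).reverse ≤ 4 * r.numStates + 1 := by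
    have := size_map_bool_le (st.rest.take r.numStates).reverse id
    rw [List.map_id, List.length_reverse, List.length_take] at this
    omega
  have hdrop : size (st.rest.drop r.numStates) ≤ size st.rest := by
    have := size_append (st.rest.take r.numStates) (st.rest.drop r.numStates)
    rw [List.take_append_drop] at this
    have := size_pos (st.rest.take r.numStates)
    omega
  have hnil : size ([] : List Bool) = 1 := rfl
  have hmod : ∀ l, (bif st.name.isEmpty && decide (1 ≤ st.stack.length) then
        (modal X r (st.stack.headD []) st.group l).elim none fun S =>
          some (⟨[], ∅, st.rest, st.occ, S :: st.stack.tail⟩ : EvalState Ag) else none) =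
        some st' → size st' ≤ size st + (8 * size r + (c + 20)) := by
    intro l h
    rcases hm : modal X r (st.stack.headD []) st.group l with _ | T
    · rw [hm, Option.elim_none] at h
      generalize (_ && _ : Bool) = b at h
      cases b <;> simp at h
    · rw [hm] at h
      rw [(hif _ _ h).1, EvalState.size_eq, EvalState.size_eq, size_cons]
      have h1 := size_modal_le X r _ _ l T hm
      have h2 := htl st.stack
      have h3 := hc ∅
      dsimp only
      omega
  cases l with
  | agent a =>
    rw [(hif _ _ h).1, EvalState.size_eq, EvalState.size_eq]
    have h3 := hc (insert a st.group)
    dsimp only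
    omega
  | bit b =>
    rw [(hif _ _ h).1, EvalState.size_eq, EvalState.size_eq, size_cons]
    have h3 := size_bool_le b
    dsimp only
    omega
  | var =>
    rw [(hif _ _ h).1, EvalState.size_eq, EvalState.size_eq, size_cons, size_cons, size_mk]
    have h3 := hc ∅
    dsimp only
    omega
  | neg =>
    rw [(hif _ _ h).1, EvalState.size_eq, EvalState.size_eq, size_cons]
    have h1 := r.size_compl_le (st.stack.headD [])
    have h2 := htl st.stack
    have h3 := hc ∅
    dsimp only
    omega
  | imp =>
    rw [(hif _ _ h).1, EvalState.size_eq, EvalState.size_eq, size_cons]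
    have h1 := r.size_imp_le (st.stack.headD []) (st.stack.tail.headD [])
    have h2 := htl st.stack
    have h4 := htl st.stack.tail
    have h3 := hc ∅
    dsimp only
    omega
  | sep => simp [evalStep] at h
  | knows => exact hmod _ h
  | commonK => exact hmod _ h
  | distributedK => exact hmod _ h
  | mutualK => exact hmod _ h

/-- The evaluation of a word from right to left. -/
noncomputable def evalWord (X : Set GroupOp) (r : RawModel) (st : EvalState Ag)
    (w : List (Letter Ag)) : Option (EvalState Ag) :=
  w.foldr (fun l o => o.elim none fun st => evalStep X r st l) (some st)

@[fun_prop]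
theorem polyTime_evalWord (X : Set GroupOp) {α : Type} [TreeEnc α]
    {r : α → RawModel} {st : α → EvalState Ag} {w : α → List (Letter Ag)}
    (hr : PolyTime r) (hst : PolyTime st) (hw : PolyTime w) :
    PolyTime (fun a => evalWord X (r a) (st a) (w a)) := by
  unfold evalWord
  refine PolyTime.foldr_of_size_add
    (g := fun r l (o : Option (EvalState Ag)) => o.elim none fun st => evalStep X r st l)
    (PolyTime.option_elim (by fun_prop) (by fun_prop)
      (polyTime_evalStep X (by fun_prop) (by fun_prop) (by fun_prop))) ?_ hr (by fun_prop) hw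
  obtain ⟨c, hc⟩ := size_evalStep_le (Ag := Ag) X
  refine ⟨8 * Polynomial.X + Polynomial.C c, fun r l o => ?_⟩
  simp only [Polynomial.eval_add, Polynomial.eval_mul, Polynomial.eval_X, Polynomial.eval_ofNat,
    Polynomial.eval_C]
  rcases o with _ | st
  · exact Nat.le_add_right _ _
  · rw [Option.elim_some]
    rcases h : evalStep X r st l with _ | st'
    · rw [size_none]
      have := size_pos (some st)
      omega
    · have := hc r st st' l h
      rw [size_some, size_some]
      omega

/-! ### The decision procedure -/

/-- The digit that a letter stands for. -/
def Letter.toBit : Letter Ag → Bool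
  | .bit b => b
  | _ => false

/-- Whether a letter is a digit. -/
def Letter.isBit : Letter Ag → Bool
  | .bit _ => true
  | _ => false

@[fun_prop]
theorem polyTime_toBit {α : Type} [TreeEnc α] {f : α → Letter Ag} (hf : PolyTime f) :
    PolyTime (fun a => (f a).toBit) := (PolyTime.of_finite Letter.toBit).comp hf

@[fun_prop]
theorem polyTime_isBit {α : Type} [TreeEnc α] {f : α → Letter Ag} (hf : PolyTime f) :
    PolyTime (fun a => (f a).isBit) := (PolyTime.of_finite Letter.isBit).comp hf

/-- Whether a letter is the separator. -/
def Letter.isSep : Letter Ag → Bool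
  | .sep => true
  | _ => false

@[fun_prop]
theorem polyTime_isSep {α : Type} [TreeEnc α] {f : α → Letter Ag} (hf : PolyTime f) :
    PolyTime (fun a => (f a).isSep) := (PolyTime.of_finite Letter.isSep).comp hf

/-- The parts of a word between separators. -/
def splitSep (w : List (Letter Ag)) : List (List (Letter Ag)) :=
  w.foldr (fun l acc => bif l.isSep then [] :: acc
    else (l :: acc.headD []) :: acc.tail) [[]]

@[fun_prop]
theorem polyTime_splitSep {α : Type} [TreeEnc α] {w : α → List (Letter Ag)} (hw : PolyTime w) :
    PolyTime (fun a => splitSep (w a)) := by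
  unfold splitSep
  refine PolyTime.foldr_of_size_add (γ := Unit)
    (g := fun _ (l : Letter Ag) acc => bif l.isSep then [] :: acc
      else (l :: acc.headD []) :: acc.tail) ?_ ?_ (.const ()) (.const _) hw
  · fun_prop
  · refine ⟨Polynomial.X + 3, fun u l acc => ?_⟩
    have hnil : size ([] : List (Letter Ag)) = 1 := rfl
    have hnil' : size ([] : List (List (Letter Ag))) = 1 := rfl
    simp only [Polynomial.eval_add, Polynomial.eval_X, Polynomial.eval_ofNat]
    cases l.isSep with
    | true =>
      simp only [Bool.cond_true, size_cons]
      omega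
    | false =>
      simp only [Bool.cond_false]
      cases acc with
      | nil => simp only [List.headD_nil, List.tail_nil, size_cons]; omega
      | cons x acc => simp only [List.headD_cons, List.tail_cons, size_cons]; omega

/-- Whether the same truth set is given at all occurrences of a variable. -/
def consistent (occ : List (List Bool × List Bool)) : Bool :=
  occ.all fun x => occ.all fun y => !(x.1 == y.1) || x.2 == y.2

@[fun_prop]
theorem polyTime_consistent {α : Type} [TreeEnc α] {f : α → List (List Bool × List Bool)}
    (hf : PolyTime f) : PolyTime (fun a => consistent (f a)) := by
  unfold consistent
  fun_prop

/-- Whether a state is the result of the evaluation of a formula that is true at the state `k`. -/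
def EvalState.accepts (st : EvalState Ag) (k : ℕ) : Bool :=
  st.name.isEmpty && decide (st.group = ∅) && st.rest.isEmpty && (st.stack.length == 1) &&
    consistent st.occ && (st.stack.headD []).getD k false

/-- The decision procedure, applied to the parts of a word. -/
noncomputable def decideParts (X : Set GroupOp) (sim : Bool) (n m k : ℕ) (f : List (Letter Ag))
    (e c v : List Bool) : Bool :=
  decide (k < n) && e.length == n * n * m && c.length == Fintype.card Ag * m &&
    (!sim || (RawModel.mk n m e c).isSimilarity) &&
    (evalWord X ⟨n, m, e, c⟩ ⟨[], ∅, v.reverse, [], []⟩ f).elim false fun st => st.accepts k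

/-- Whether the parts of a word, except for the formula, consist of digits. -/
def wellFormed (p : List (List (Letter Ag))) : Bool :=
  p.length == 7 && (p.getD 0 []).all Letter.toBit && (p.getD 1 []).all Letter.toBit &&
    (p.getD 2 []).all Letter.toBit && (p.getD 4 []).all Letter.isBit &&
    (p.getD 5 []).all Letter.isBit && (p.getD 6 []).all Letter.isBit

/-- The decision procedure. -/
noncomputable def decideWord (X : Set GroupOp) (sim : Bool) (w : List (Letter Ag)) : Bool :=
  wellFormed (splitSep w) &&
    decideParts X sim ((splitSep w).getD 0 []).length ((splitSep w).getD 1 []).length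
      ((splitSep w).getD 2 []).length ((splitSep w).getD 3 [])
      (((splitSep w).getD 4 []).map Letter.toBit) (((splitSep w).getD 5 []).map Letter.toBit)
      (((splitSep w).getD 6 []).map Letter.toBit)

@[fun_prop]
theorem polyTime_decideParts (X : Set GroupOp) (sim : Bool) {α : Type} [TreeEnc α]
    {n m k : α → ℕ} {f : α → List (Letter Ag)} {e c v : α → List Bool} (hn : PolyTime n)
    (hm : PolyTime m) (hk : PolyTime k) (hf : PolyTime f) (he : PolyTime e) (hc : PolyTime c)
    (hv : PolyTime v) :
    PolyTime (fun a => decideParts X sim (n a) (m a) (k a) (f a) (e a) (c a) (v a)) := by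
  unfold decideParts EvalState.accepts
  have h0 : ∀ {β : Type} [TreeEnc β] {st : β → EvalState Ag}, PolyTime st →
      PolyTime fun x => decide ((st x).group = ∅) := fun hst =>
    (PolyTime.of_finite fun G : Finset Ag => decide (G = ∅)).comp (by fun_prop)
  have h1 := PolyTime.option_elim (f := fun _ => false)
    (polyTime_evalWord X (r := fun a => ⟨n a, m a, e a, c a⟩)
      (st := fun a => ⟨[], ∅, (v a).reverse, [], []⟩) (w := f) (by fun_prop) (by fun_prop) hf)
    (.const false)
    (g := fun a st => st.name.isEmpty && decide (st.group = ∅) && st.rest.isEmpty &&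
      (st.stack.length == 1) && consistent st.occ && (st.stack.headD []).getD (k a) false) (by
      have := h0 (st := fun p : α × EvalState Ag => p.2) (by fun_prop)
      fun_prop)
  fun_prop

theorem polyTime_decideWord (X : Set GroupOp) (sim : Bool) :
    PolyTime (decideWord X sim : List (Letter Ag) → Bool) := by
  unfold decideWord wellFormed
  fun_prop

end

/-! ### Bit lists of sets and models -/

open Classical in
/-- The characteristic list of a set. -/
noncomputable def setBits {n : ℕ} (S : Set (Fin n)) : List Bool :=
  (List.finRange n).map fun i => decide (i ∈ S)

theorem length_setBits {n : ℕ} (S : Set (Fin n)) : (setBits S).length = n := by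
  simp [setBits]

theorem getD_setBits {n : ℕ} (S : Set (Fin n)) (i : Fin n) :
    (setBits S).getD i false = true ↔ i ∈ S := by
  rw [List.getD_eq_getElem _ _ (by rw [length_setBits]; exact i.isLt)]
  simp [setBits]

theorem eq_setBits {n : ℕ} {l : List Bool} {S : Set (Fin n)} (hl : l.length = n)
    (h : ∀ i : Fin n, l.getD i false = true ↔ i ∈ S) : l = setBits S := by
  refine List.ext_getElem (by rw [hl, length_setBits]) fun i hi hi' => ?_
  have h1 := h ⟨i, hl ▸ hi⟩
  rw [← getD_setBits, ← Bool.eq_iff_iff] at h1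
  rwa [List.getD_eq_getElem _ _ hi, List.getD_eq_getElem _ _ hi'] at h1

theorem map_range_eq_setBits {n : ℕ} {g : ℕ → Bool} {S : Set (Fin n)}
    (h : ∀ i : Fin n, g i = true ↔ i ∈ S) : (List.range n).map g = setBits S := by
  refine eq_setBits (by simp) fun i => ?_
  rw [← h i, List.getD_eq_getElem _ _ (by simp)]
  simp

theorem all_range_iff {n : ℕ} {p : ℕ → Bool} :
    (List.range n).all p = true ↔ ∀ i : Fin n, p i = true := by
  rw [List.all_eq_true]
  exact ⟨fun h i => h i (List.mem_range.2 i.isLt), fun h i hi => h ⟨i, List.mem_range.1 hi⟩⟩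

theorem setCode_eq {Ag : Type} {n : ℕ} (S : Set (Fin n)) :
    (setCode S : List (Letter Ag)) = (setBits S).map Letter.bit := by
  simp [setCode, setBits]

theorem getD_flatMap {A : Type} (f : A → List Bool) (m : ℕ) (hf : ∀ a, (f a).length = m) :
    ∀ (L : List A) (k : ℕ) (hk : k < L.length) (j : ℕ), j < m →
      (L.flatMap f).getD (k * m + j) false = (f L[k]).getD j false
  | a :: L, 0, _, j, hj => by
    rw [List.flatMap_cons, Nat.zero_mul, Nat.zero_add, List.getD_append _ _ _ _ (by rw [hf]; exact hj)]
    rfl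
  | a :: L, k + 1, hk, j, hj => by
    have e : (k + 1) * m + j - m = k * m + j := by rw [Nat.succ_mul]; omega
    rw [List.flatMap_cons, List.getD_append_right _ _ _ _ (by rw [hf, Nat.succ_mul]; omega), hf, e,
      getD_flatMap f m hf L k (Nat.lt_of_succ_lt_succ hk) j hj]
    rfl

theorem length_flatMap_of_length {A : Type} (f : A → List Bool) (m : ℕ)
    (hf : ∀ a, (f a).length = m) (L : List A) : (L.flatMap f).length = L.length * m := by
  simp [List.length_flatMap, hf]

section

variable {Ag : Type} [Fintype Ag] [LinearOrder Ag] {n m : ℕ}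

/-- The bits of the edge function. -/
noncomputable def edgeBits (M : Model Ag (Fin n) (Fin m)) : List Bool :=
  (List.finRange n).flatMap fun s => (List.finRange n).flatMap fun t => setBits (M.edge s t)

/-- The bits of the capability function. -/
noncomputable def capBits (M : Model Ag (Fin n) (Fin m)) : List Bool :=
  ((Finset.univ : Finset Ag).sort (· ≤ ·)).flatMap fun a => setBits (M.cap a)

/-- The bits of the valuation at the occurrences of variables in a formula. -/
noncomputable def valBits (M : Model Ag (Fin n) (Fin m)) (φ : Formula Ag) : List Bool :=
  φ.varOccs.flatMap fun p => setBits {s | p ∈ M.val s}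

theorem edgeCode_eq (M : Model Ag (Fin n) (Fin m)) :
    edgeCode M = (edgeBits M).map Letter.bit := by
  simp only [edgeCode, edgeBits, List.map_flatMap, setCode_eq]

theorem capCode_eq (M : Model Ag (Fin n) (Fin m)) :
    capCode M = (capBits M).map Letter.bit := by
  simp only [capCode, capBits, List.map_flatMap, setCode_eq]

theorem valCode_eq (M : Model Ag (Fin n) (Fin m)) (φ : Formula Ag) :
    valCode M φ = (valBits M φ).map Letter.bit := by
  simp only [valCode, valBits, List.map_flatMap, setCode_eq]

theorem length_edgeBits (M : Model Ag (Fin n) (Fin m)) : (edgeBits M).length = n * n * m := by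
  rw [edgeBits, length_flatMap_of_length _ (n * m)]
  · simp [Nat.mul_assoc]
  · intro s
    rw [length_flatMap_of_length _ m fun t => length_setBits _]
    simp

theorem length_capBits (M : Model Ag (Fin n) (Fin m)) :
    (capBits M).length = Fintype.card Ag * m := by
  rw [capBits, length_flatMap_of_length _ m fun t => length_setBits _]
  simp

theorem agentIndex_lt (a : Ag) :
    RawModel.agentIndex a < ((Finset.univ : Finset Ag).sort (· ≤ ·)).length :=
  List.idxOf_lt_length_of_mem (by simp)

/-- The raw model of a model. -/
noncomputable def Model.raw (M : Model Ag (Fin n) (Fin m)) : RawModel :=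
  ⟨n, m, edgeBits M, capBits M⟩

theorem edgeBit_raw (M : Model Ag (Fin n) (Fin m)) (s t : Fin n) (i : Fin m) :
    M.raw.edgeBit s t i = true ↔ i ∈ M.edge s t := by
  -- The bits form `n` rows of length `n * m`, each of which consists of `n` blocks of length `m`.
  have e : (s.val * n + t) * m + i = s.val * (n * m) + (t * m + i) := by ring
  have h1 : t.val * m + i < n * m := by
    have := Nat.mul_le_mul_right m (Nat.succ_le_of_lt t.isLt)
    rw [Nat.succ_mul] at this
    have := i.isLt
    omega
  rw [RawModel.edgeBit, Model.raw]
  dsimp only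
  rw [e, edgeBits, getD_flatMap _ (n * m) _ _ s (by simp) _ h1,
    getD_flatMap _ m (fun t => length_setBits _) _ t (by simp) _ i.isLt, getD_setBits]
  · simp
  · intro s
    rw [length_flatMap_of_length _ m fun t => length_setBits _]
    simp

theorem capBit_raw (M : Model Ag (Fin n) (Fin m)) (a : Ag) (i : Fin m) :
    M.raw.capBit a i = true ↔ i ∈ M.cap a := by
  rw [RawModel.capBit, Model.raw]
  dsimp only
  rw [capBits, getD_flatMap _ m (fun t => length_setBits _) _ _ (agentIndex_lt a) _ i.isLt,
    getD_setBits]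
  simp [RawModel.agentIndex]

theorem isSimilarity_raw (M : Model Ag (Fin n) (Fin m)) :
    M.raw.isSimilarity = true ↔ M.IsSimilarity := by
  have h1 : ∀ s t : Fin n, (List.range m).all (fun i => M.raw.edgeBit s t i) = true ↔
      M.edge s t = Set.univ := fun s t => by
    simp only [all_range_iff, edgeBit_raw, Set.eq_univ_iff_forall]
  have h2 : ∀ s t : Fin n,
      (List.range m).all (fun i => M.raw.edgeBit s t i == M.raw.edgeBit t s i) = true ↔
      M.edge s t = M.edge t s := fun s t => by
    rw [all_range_iff, Set.ext_iff]
    refine forall_congr' fun i => ?_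
    rw [beq_iff_eq, Bool.eq_iff_iff, edgeBit_raw, edgeBit_raw]
  have h3 : M.raw.isSimilarity = true ↔ ∀ s t : Fin n,
      (s.val = t.val ∨ ¬ M.edge s t = Set.univ) ∧ M.edge s t = M.edge t s := by
    refine (all_range_iff (n := n)).trans (forall_congr' fun s =>
      (all_range_iff (n := n)).trans (forall_congr' fun t => ?_))
    rw [← h1, ← h2, Bool.and_eq_true, Bool.or_eq_true, beq_iff_eq, Bool.not_eq_true',
      Bool.not_eq_true]
    rfl
  rw [h3, Model.IsSimilarity]
  constructor
  · exact fun h => ⟨fun s t hst => Fin.ext ((h s t).1.resolve_right (not_not.2 hst)),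
      fun s t => (h s t).2⟩
  · rintro ⟨h, h'⟩ s t
    refine ⟨?_, h' s t⟩
    by_cases hst : M.edge s t = Set.univ
    · exact Or.inl (congrArg Fin.val (h s t hst))
    · exact Or.inr hst

/-- A list of bits of the right length is that of the model it defines. -/
theorem exists_model (e c : List Bool) (he : e.length = n * n * m)
    (hc : c.length = Fintype.card Ag * m) (val : Fin n → Set ℕ) :
    ∃ M : Model Ag (Fin n) (Fin m), edgeBits M = e ∧ capBits M = c ∧ M.val = val := by
  let M : Model Ag (Fin n) (Fin m) :=
    { edge := fun s t => {i | e.getD ((s * n + t) * m + i) false = true}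
      cap := fun a => {i | c.getD (RawModel.agentIndex a * m + i) false = true}
      val := val }
  have ext : ∀ l l' : List Bool, l.length = l'.length →
      (∀ k < l.length, l.getD k false = l'.getD k false) → l = l' := by
    intro l l' hl h
    refine List.ext_getElem hl fun i hi hi' => ?_
    have := h i hi
    rwa [List.getD_eq_getElem _ _ hi, List.getD_eq_getElem _ _ hi'] at this
  refine ⟨M, ext _ _ (by rw [length_edgeBits, he]) fun k hk => ?_,
    ext _ _ (by rw [length_capBits, hc]) fun k hk => ?_, rfl⟩
  · rw [length_edgeBits] at hk
    have hm : 0 < m := by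
      rcases Nat.eq_zero_or_pos m with h | h
      · simp [h] at hk
      · exact h
    have hkm : k / m < n * n := Nat.div_lt_of_lt_mul (by rwa [Nat.mul_comm] at hk)
    have hn : 0 < n := by
      rcases Nat.eq_zero_or_pos n with h | h
      · simp [h] at hkm
      · exact h
    -- Position `k` lies in the block `k / m`, whose pair of states is found by division by `n`, and
    -- belongs to the ability `k % m`.
    have h := edgeBit_raw M ⟨k / m / n, Nat.div_lt_of_lt_mul hkm⟩ ⟨k / m % n, Nat.mod_lt _ hn⟩
      ⟨k % m, Nat.mod_lt _ hm⟩
    simp only [RawModel.edgeBit, Model.raw, M, Set.mem_ofPred_eq, Nat.div_add_mod',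
      ← Bool.eq_iff_iff] at h
    exact h
  · rw [length_capBits] at hk
    have hm : 0 < m := by
      rcases Nat.eq_zero_or_pos m with h | h
      · simp [h] at hk
      · exact h
    have hkm : k / m < ((Finset.univ : Finset Ag).sort (· ≤ ·)).length := by
      simpa using Nat.div_lt_of_lt_mul (by rwa [Nat.mul_comm] at hk)
    have h := capBit_raw M (((Finset.univ : Finset Ag).sort (· ≤ ·))[k / m])
      ⟨k % m, Nat.mod_lt _ hm⟩
    have hidx : RawModel.agentIndex (((Finset.univ : Finset Ag).sort (· ≤ ·))[k / m]) = k / m :=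
      List.Nodup.idxOf_getElem (Finset.sort_nodup _ _) _ _
    simp only [RawModel.capBit, Model.raw, M, Set.mem_ofPred_eq, hidx, Nat.div_add_mod',
      ← Bool.eq_iff_iff] at h
    exact h

/-! ### Truth sets -/

theorem box_setBits (M : Model Ag (Fin n) (Fin m)) {rel : ℕ → ℕ → Bool} {S T : Set (Fin n)}
    (h : ∀ s, s ∈ T ↔ ∀ t : Fin n, rel s t = true → t ∈ S) :
    M.raw.box rel (setBits S) = setBits T := by
  refine map_range_eq_setBits (n := n) fun s => ?_
  rw [h]
  refine (all_range_iff (n := n)).trans (forall_congr' fun t => ?_)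
  rw [Bool.or_eq_true, getD_setBits, Bool.not_eq_true', ← Bool.not_eq_true, imp_iff_not_or]

theorem compl_setBits (M : Model Ag (Fin n) (Fin m)) (S : Set (Fin n)) :
    M.raw.compl (setBits S) = setBits Sᶜ :=
  map_range_eq_setBits (n := n) fun s => by
    rw [Bool.not_eq_true', ← Bool.not_eq_true, getD_setBits, Set.mem_compl_iff]

theorem imp_setBits (M : Model Ag (Fin n) (Fin m)) (S T : Set (Fin n)) :
    M.raw.imp (setBits S) (setBits T) = setBits {s | s ∈ S → s ∈ T} :=
  map_range_eq_setBits (n := n) fun s => by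
    rw [Bool.or_eq_true, Bool.not_eq_true', ← Bool.not_eq_true, getD_setBits, getD_setBits,
      Set.mem_ofPred_eq, imp_iff_not_or]

theorem relAgent_raw (M : Model Ag (Fin n) (Fin m)) (a : Ag) (s t : Fin n) :
    M.raw.relAgent a s t = true ↔ M.cap a ⊆ M.edge s t := by
  refine (all_range_iff (n := m)).trans (forall_congr' fun i => ?_)
  rw [Bool.or_eq_true, Bool.not_eq_true', ← Bool.not_eq_true, capBit_raw, edgeBit_raw,
    imp_iff_not_or]

theorem relE_raw (M : Model Ag (Fin n) (Fin m)) (G : Finset Ag) (s t : Fin n) :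
    M.raw.relE G s t = true ↔ ∃ a ∈ G, M.cap a ⊆ M.edge s t := by
  simp [RawModel.relE, relAgent_raw]

theorem relD_raw (M : Model Ag (Fin n) (Fin m)) (G : Finset Ag) (s t : Fin n) :
    M.raw.relD G s t = true ↔ (⋃ a ∈ G, M.cap a) ⊆ M.edge s t := by
  simp [RawModel.relD, relAgent_raw]

theorem relM_raw (M : Model Ag (Fin n) (Fin m)) (G : Finset Ag) (s t : Fin n) :
    M.raw.relM G s t = true ↔ (⋂ a ∈ G, M.cap a) ⊆ M.edge s t := by
  refine (all_range_iff (n := m)).trans (forall_congr' fun i => ?_)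
  rw [Bool.or_eq_true, Bool.not_eq_true', ← Bool.not_eq_true, edgeBit_raw, ← imp_iff_not_or]
  simp [capBit_raw]

/-- As long as the chain has not stopped, every step removes a state, so `j + 1` proper steps leave
at most `n - (j + 1)` states. There is no room for `n + 1` proper steps. -/
theorem eq_of_antitone_iterate {A : ℕ → Set (Fin n)} (hA : ∀ j, A (j + 1) ⊆ A j)
    (hs : ∀ j, A (j + 1) = A j → A (j + 2) = A (j + 1)) : ∀ j, A (n + j) = A n := by
  have h : ∀ j, A (j + 1) = A j ∨ (A (j + 1)).ncard + (j + 1) ≤ n := by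
    intro j
    induction j with
    | zero =>
      rcases (hA 0).eq_or_ssubset with h | h
      · exact Or.inl h
      · have h1 := Set.ncard_lt_ncard h
        have h2 := Set.ncard_le_card (A 0)
        rw [Nat.card_eq_fintype_card, Fintype.card_fin] at h2
        exact Or.inr (by omega)
    | succ j ih =>
      rcases ih with ih | ih
      · exact Or.inl (hs j ih)
      · rcases (hA (j + 1)).eq_or_ssubset with h | h
        · exact Or.inl h
        · have h1 := Set.ncard_lt_ncard h
          exact Or.inr (by omega)
  have h1 : A (n + 1) = A n := (h n).resolve_right (by omega)
  have h2 : ∀ j, A (n + j + 1) = A (n + j) := by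
    intro j
    induction j with
    | zero => exact h1
    | succ j ih => exact hs _ ih
  intro j
  induction j with
  | zero => rfl
  | succ j ih => exact (h2 j).trans ih

/-- A conjunction of boxes is the box along the union of their relations. -/
theorem mem_everyone_iff (M : Model Ag (Fin n) (Fin m)) (G : AgentGroup Ag) (S : Set (Fin n))
    (s : Fin n) : s ∈ M.everyone G S ↔ ∀ t : Fin n, M.raw.relE G.1 s t = true → t ∈ S := by
  simp only [relE_raw]
  exact ⟨fun h t ⟨a, ha, hst⟩ => h a ha t hst, fun h a ha t hst => h t ⟨a, ha, hst⟩⟩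

/-- With `A j` the common knowledge truncated at depth `j`, one round of the iteration leads from `A
j` to `A (j + 1)`, and the chain is stationary from `A n` on. -/
theorem common_setBits (M : Model Ag (Fin n) (Fin m)) (G : AgentGroup Ag) (S : Set (Fin n)) :
    M.raw.common (M.raw.relE G.1) (setBits S) =
      setBits {s | ∀ k : ℕ, 1 ≤ k → s ∈ (M.everyone G)^[k] S} := by
  let A : ℕ → Set (Fin n) := fun j => {s | ∀ k : ℕ, 1 ≤ k → k ≤ j → s ∈ (M.everyone G)^[k] S}
  -- Depth 1 requires `S` at all successors, and depth `k + 1` with `1 ≤ k ≤ j` requires depth `k`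
  -- there.
  have hstep : ∀ j s, s ∈ A (j + 1) ↔ ∀ t : Fin n, M.raw.relE G.1 s t = true → t ∈ S ∩ A j := by
    intro j s
    constructor
    · intro h t hst
      refine ⟨(mem_everyone_iff M G S s).1 (h 1 le_rfl (by omega)) t hst, fun k hk hkj => ?_⟩
      have := h (k + 1) (by omega) (by omega)
      rw [Function.iterate_succ_apply'] at this
      exact (mem_everyone_iff M G _ s).1 this t hst
    · intro h k hk hkj
      obtain ⟨k, rfl⟩ : ∃ k', k = k' + 1 := ⟨k - 1, by omega⟩
      rw [Function.iterate_succ_apply', mem_everyone_iff]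
      intro t hst
      rcases Nat.eq_zero_or_pos k with rfl | hk0
      · exact (h t hst).1
      · exact (h t hst).2 k hk0 (by omega)
  -- The intersection `S ∩ T` is written with complement and implication, and the starting value, a
  -- box along the empty relation, is the set of all states.
  have hiter : ∀ j, (fun T => M.raw.box (M.raw.relE G.1)
      (M.raw.compl (M.raw.imp (setBits S) (M.raw.compl T))))^[j]
        (M.raw.box (fun _ _ => false) []) = setBits (A j) := by
    intro j
    induction j with
    | zero =>
      refine map_range_eq_setBits (n := n) fun s => ?_
      simp only [Bool.not_false, Bool.true_or, List.all_eq_true, implies_true, true_iff]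
      intro k hk hk'
      omega
    | succ j ih =>
      rw [Function.iterate_succ_apply', ih, compl_setBits, imp_setBits, compl_setBits]
      refine box_setBits M fun s => (hstep j s).trans ?_
      simp
  have hstable := eq_of_antitone_iterate (A := A) (fun j s h k hk hkj => h k hk (by omega))
    (fun j h => by
      ext s
      rw [hstep, hstep, h])
  refine (hiter n).trans (congrArg setBits ?_)
  ext s
  constructor
  · intro h k hk
    rw [← hstable k] at h
    exact h k hk (by omega)
  · exact fun h k hk _ => h k hk

end

/-! ### Evaluation of the code of a formula -/

section

variable {Ag : Type} [Fintype Ag] [LinearOrder Ag] {n m : ℕ}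

theorem evalWord_cons (X : Set GroupOp) (r : RawModel) (st : EvalState Ag) (l : Letter Ag)
    (w : List (Letter Ag)) : evalWord X r st (l :: w) =
      (evalWord X r st w).elim none fun st => evalStep X r st l := rfl

theorem evalWord_append (X : Set GroupOp) (r : RawModel) (st : EvalState Ag)
    (u w : List (Letter Ag)) : evalWord X r st (u ++ w) =
      (evalWord X r st w).elim none fun st => evalWord X r st u := by
  induction u with
  | nil =>
    rw [List.nil_append]
    cases evalWord X r st w <;> rfl
  | cons l u ih =>
    rw [List.cons_append, evalWord_cons, ih]
    cases evalWord X r st w <;> rfl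

theorem evalWord_bits (X : Set GroupOp) (r : RawModel) (l : List Bool) (rest : List Bool)
    (occ : List (List Bool × List Bool)) (stack : List (List Bool)) :
    evalWord X r (⟨[], ∅, rest, occ, stack⟩ : EvalState Ag) (l.map Letter.bit) =
      some ⟨l, ∅, rest, occ, stack⟩ := by
  induction l with
  | nil => rfl
  | cons b l ih =>
    rw [List.map_cons, evalWord_cons, ih]
    simp [evalStep]

/-- From right to left the agents appear in decreasing order, so each of them passes the test of
being smaller than all pending ones. -/
theorem evalWord_agents (X : Set GroupOp) (r : RawModel) (rest : List Bool)
    (occ : List (List Bool × List Bool)) (stack : List (List Bool)) (L : List Ag)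
    (hL : L.Pairwise (· < ·)) :
    evalWord X r (⟨[], ∅, rest, occ, stack⟩ : EvalState Ag) (L.map Letter.agent) =
      some ⟨[], L.toFinset, rest, occ, stack⟩ := by
  induction L with
  | nil => rfl
  | cons a L ih =>
    rw [List.pairwise_cons] at hL
    rw [List.map_cons, evalWord_cons, ih hL.2, List.toFinset_cons]
    have : ∀ b ∈ L.toFinset, a < b := fun b hb => hL.1 b (List.mem_toFinset.1 hb)
    simp only [Option.elim_some, evalStep, List.isEmpty_nil]
    rw [decide_eq_true this]
    rfl

theorem evalWord_group (X : Set GroupOp) (r : RawModel) (rest : List Bool)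
    (occ : List (List Bool × List Bool)) (stack : List (List Bool)) (G : Finset Ag) :
    evalWord X r (⟨[], ∅, rest, occ, stack⟩ : EvalState Ag) (agentLetters G) =
      some ⟨[], G, rest, occ, stack⟩ := by
  rw [agentLetters, evalWord_agents X r rest occ stack _ (Finset.sortedLT_sort G).pairwise,
    Finset.sort_toFinset]

/-- The occurrences of variables in a formula and the truth sets of these variables. -/
noncomputable def occs (M : Model Ag (Fin n) (Fin m)) (φ : Formula Ag) :
    List (List Bool × List Bool) :=
  φ.varOccs.map fun p => (Computability.encodeNat p, setBits {s | p ∈ M.val s})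

/-- The least significant digit comes first, so the leading digit is the last one and must be
`true`; zero is the empty word, which explains the default in `isNumeral`. -/
theorem isNumeral_encodeNat (p : ℕ) : isNumeral (Computability.encodeNat p) = true := by
  have h : ∀ k : PosNum, (Computability.encodePosNum k).reverse.headD true = true := by
    intro k
    induction k with
    | one => rfl
    | bit0 k ih | bit1 k ih =>
      rw [Computability.encodePosNum, List.reverse_cons]
      have hne := Computability.encodePosNum_nonempty k
      revert ih
      cases hr : (Computability.encodePosNum k).reverse with
      | nil => exact absurd (List.reverse_eq_nil_iff.1 hr) hne
      | cons b l => exact fun ih => ih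
  unfold isNumeral Computability.encodeNat Computability.encodeNum
  cases (p : Num) with
  | zero => rfl
  | pos k => exact h k

theorem exists_encodeNat {l : List Bool} (hl : isNumeral l = true) :
    ∃ p, Computability.encodeNat p = l := by
  have h : ∀ l : List Bool, l ≠ [] → isNumeral l = true →
      ∃ k : PosNum, Computability.encodePosNum k = l := by
    intro l
    induction l with
    | nil => exact fun h => absurd rfl h
    | cons b l ih =>
      intro _ hb
      by_cases hl : l = []
      · subst hl
        have : b = true := hb
        exact ⟨.one, by rw [this, Computability.encodePosNum]⟩
      · obtain ⟨k, hk⟩ := ih hl (by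
          unfold isNumeral at hb ⊢
          rw [List.reverse_cons] at hb
          cases hr : l.reverse with
          | nil => rfl
          | cons c t => rw [hr] at hb; exact hb)
        cases b
        · exact ⟨.bit0 k, by rw [Computability.encodePosNum, hk]⟩
        · exact ⟨.bit1 k, by rw [Computability.encodePosNum, hk]⟩
  by_cases hne : l = []
  · exact ⟨0, by rw [hne]; rfl⟩
  · obtain ⟨k, hk⟩ := h l hne hl
    refine ⟨(k : ℕ), ?_⟩
    have e : (((k : ℕ) : Num)) = Num.pos k := by
      simp
    rw [Computability.encodeNat, e, Computability.encodeNum, hk]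

theorem encodeNat_injective : Function.Injective Computability.encodeNat :=
  Function.LeftInverse.injective Computability.decode_encodeNat

theorem evalStep_var (X : Set GroupOp) (r : RawModel) (p : ℕ) (v rest : List Bool)
    (hv : v.length = r.numStates) (occ : List (List Bool × List Bool))
    (stack : List (List Bool)) :
    evalStep X r (⟨Computability.encodeNat p, ∅, v.reverse ++ rest, occ, stack⟩ : EvalState Ag)
      .var = some ⟨[], ∅, rest, (Computability.encodeNat p, v) :: occ, v :: stack⟩ := by
  have h1 : (v.reverse ++ rest).take r.numStates = v.reverse :=
    List.take_left' (by rw [List.length_reverse, hv])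
  have h2 : (v.reverse ++ rest).drop r.numStates = rest :=
    List.drop_left' (by rw [List.length_reverse, hv])
  have h3 : r.numStates ≤ (v.reverse ++ rest).length := by
    rw [List.length_append, List.length_reverse, hv]
    omega
  simp only [evalStep, isNumeral_encodeNat, h1, h2, h3, decide_true, Bool.and_self, Bool.cond_true,
    List.reverse_reverse]

/-- The truth set of a formula. -/
noncomputable def truth (M : Model Ag (Fin n) (Fin m)) (φ : Formula Ag) : List Bool :=
  setBits {s | M.Sat φ s}

/-- The evaluation of `φ` consumes exactly its own bits of the valuation and pushes one truth set,
whatever else is in the state; this generality is what the induction needs for implications. The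
bits are reversed because the last variable is met first. -/
theorem evalWord_code (X : Set GroupOp) (M : Model Ag (Fin n) (Fin m)) (φ : Formula Ag) :
    φ.InLang X → ∀ rest occ stack,
      evalWord X M.raw (⟨[], ∅, (valBits M φ).reverse ++ rest, occ, stack⟩ : EvalState Ag) φ.code =
        some ⟨[], ∅, rest, occs M φ ++ occ, truth M φ :: stack⟩ := by
  have hbox : ∀ {rel : ℕ → ℕ → Bool} {ψ χ : Formula Ag}, (∀ s, M.Sat χ s ↔
      ∀ t : Fin n, rel s t = true → M.Sat ψ t) → M.raw.box rel (truth M ψ) = truth M χ :=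
    fun h => box_setBits M h
  induction φ with
  | var p =>
    intro _ rest occ stack
    rw [Formula.code, evalWord_cons, evalWord_bits, Option.elim_some]
    have e : valBits M (Formula.var p : Formula Ag) = setBits {s | p ∈ M.val s} := by
      simp [valBits, Formula.varOccs]
    rw [e, evalStep_var X M.raw p (setBits {s | p ∈ M.val s}) rest (length_setBits (n := n) _)]
    rfl
  | neg φ ih =>
    intro h rest occ stack
    rw [Formula.code, evalWord_cons]
    have e : valBits M φ.neg = valBits M φ := rfl
    rw [e, ih h, Option.elim_some]
    have e2 : M.raw.compl (truth M φ) = truth M φ.neg := compl_setBits M _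
    simp [evalStep, e2, occs, Formula.varOccs]
  | imp φ ψ ih ih' =>
    intro h rest occ stack
    rw [Formula.code, evalWord_cons, evalWord_append]
    have e : valBits M (φ.imp ψ) = valBits M φ ++ valBits M ψ := by
      simp [valBits, Formula.varOccs]
    -- The right-hand side `ψ` is read first, which leaves the truth set of `φ` on top.
    rw [e, List.reverse_append, List.append_assoc, ih' h.2, Option.elim_some, ih h.1,
      Option.elim_some]
    have e2 : M.raw.imp (truth M φ) (truth M ψ) = truth M (φ.imp ψ) := imp_setBits M _ _
    simp [evalStep, e2, occs, Formula.varOccs]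
  | knows a φ ih =>
    intro h rest occ stack
    -- The agent of `K_a` is read as a pending singleton group, and `K_a` is evaluated as `D_{a}`.
    have e0 : (Formula.knows a φ).code = Letter.knows :: (agentLetters {a} ++ φ.code) := by
      simp [agentLetters, Formula.code]
    have e : valBits M (φ.knows a) = valBits M φ := rfl
    rw [e0, evalWord_cons, evalWord_append, e, ih h, Option.elim_some, evalWord_group,
      Option.elim_some]
    have e2 : M.raw.box (M.raw.relD {a}) (truth M φ) = truth M (φ.knows a) :=
      hbox fun s => forall_congr' fun t => by simp [relD_raw]
    simp [evalStep, modal, e2, occs, Formula.varOccs]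
  | commonK G φ ih =>
    intro h rest occ stack
    have e : valBits M (φ.commonK G) = valBits M φ := rfl
    rw [Formula.code, evalWord_cons, evalWord_append, e, ih h.2, Option.elim_some, evalWord_group,
      Option.elim_some]
    have e2 : M.raw.common (M.raw.relE G.1) (truth M φ) = truth M (φ.commonK G) :=
      common_setBits M G _
    simp [evalStep, modal, e2, occs, Formula.varOccs, G.2, h.1]
  | distributedK G φ ih =>
    intro h rest occ stack
    have e : valBits M (φ.distributedK G) = valBits M φ := rfl
    rw [Formula.code, evalWord_cons, evalWord_append, e, ih h.2, Option.elim_some, evalWord_group,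
      Option.elim_some]
    have e2 : M.raw.box (M.raw.relD G.1) (truth M φ) = truth M (φ.distributedK G) :=
      hbox fun s => forall_congr' fun t => by rw [relD_raw]
    simp [evalStep, modal, e2, occs, Formula.varOccs, G.2, h.1]
  | mutualK G φ ih =>
    intro h rest occ stack
    have e : valBits M (φ.mutualK G) = valBits M φ := rfl
    rw [Formula.code, evalWord_cons, evalWord_append, e, ih h.2, Option.elim_some, evalWord_group,
      Option.elim_some]
    have e2 : M.raw.box (M.raw.relM G.1) (truth M φ) = truth M (φ.mutualK G) :=
      hbox fun s => forall_congr' fun t => by rw [relM_raw]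
    simp [evalStep, modal, e2, occs, Formula.varOccs, G.2, h.1]

/-! ### Words that can be evaluated are codes of formulas -/

/-- The state `st` arises from the word `w`, which is a pending variable or group followed by the
codes of the formulas `φs`. -/
structure EvalInv (X : Set GroupOp) (r : RawModel) (v : List Bool) (w : List (Letter Ag))
    (st : EvalState Ag) (φs : List (Formula Ag)) : Prop where
  word : w = agentLetters st.group ++ (st.name.map Letter.bit ++ φs.flatMap Formula.code)
  pending : st.group = ∅ ∨ st.name = []
  inLang : ∀ φ ∈ φs, φ.InLang X
  names : st.occ.map Prod.fst = (φs.flatMap Formula.varOccs).map Computability.encodeNat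
  lengths : ∀ x ∈ st.occ, x.2.length = r.numStates
  bits : v = st.rest.reverse ++ st.occ.flatMap Prod.snd
  stack : st.stack.length = φs.length

/-- Common part of the four modalities: the pending group and the first formula merge into one
formula, supplied by `hl`. -/
theorem evalInv_modal {X : Set GroupOp} {r : RawModel} {v : List Bool} {w : List (Letter Ag)}
    {st st' : EvalState Ag} {φs : List (Formula Ag)} {l : Letter Ag}
    (hst : EvalInv X r v w st φs)
    (h : (bif st.name.isEmpty && decide (1 ≤ st.stack.length) then
        (modal X r (st.stack.headD []) st.group l).elim none fun S =>
          some (⟨[], ∅, st.rest, st.occ, S :: st.stack.tail⟩ : EvalState Ag) else none) = some st')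
    (hl : ∀ (S T : List Bool) (G : Finset Ag), modal X r S G l = some T → ∀ φ : Formula Ag,
      φ.InLang X → ∃ ψ : Formula Ag, ψ.InLang X ∧ ψ.varOccs = φ.varOccs ∧
        ψ.code = l :: (agentLetters G ++ φ.code)) :
    ∃ φs', EvalInv X r v (l :: w) st' φs' := by
  obtain ⟨name, group, rest, occ, stack⟩ := st
  obtain ⟨h1, h2, h3, h4, h5, h6, h7⟩ := hst
  dsimp only at *
  rcases hc : name.isEmpty && decide (1 ≤ stack.length) with _ | _
  · rw [hc] at h
    simp at h
  rcases hm : modal X r (stack.headD []) group l with _ | T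
  · rw [hm] at h
    cases hc' : (name.isEmpty && decide (1 ≤ stack.length)) <;> rw [hc'] at h <;> simp at h
  rw [hc, hm] at h
  have h' : (⟨[], ∅, rest, occ, T :: stack.tail⟩ : EvalState Ag) = st' := Option.some_injective _ h
  subst h'
  simp only [Bool.and_eq_true, List.isEmpty_iff, decide_eq_true_eq] at hc
  obtain ⟨rfl, hs⟩ := hc
  obtain _ | ⟨φ, φs⟩ := φs
  · simp at h7
    simp [h7] at hs
  obtain ⟨ψ, hψ, hψo, hψc⟩ := hl _ _ _ hm φ (h3 φ (by simp))
  refine ⟨ψ :: φs, ?_, Or.inl rfl, ?_, ?_, h5, h6, ?_⟩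
  · rw [h1]
    simp [hψc, agentLetters]
  · intro χ hχ
    rcases List.mem_cons.1 hχ with rfl | hχ
    · exact hψ
    · exact h3 χ (by simp [hχ])
  · rw [h4]
    simp [hψo]
  · simp only [List.length_cons, List.length_tail] at h7 ⊢
    omega

/-- Each test in `evalStep` is what is needed to continue parsing. Of the stack only the height is
tracked: once the word is known to be a code, its truth value is given by `evalWord_code`. -/
theorem evalInv_step {X : Set GroupOp} {r : RawModel} {v : List Bool} {w : List (Letter Ag)}
    {st st' : EvalState Ag} {φs : List (Formula Ag)} {l : Letter Ag}
    (hst : EvalInv X r v w st φs) (h : evalStep X r st l = some st') :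
    ∃ φs', EvalInv X r v (l :: w) st' φs' := by
  have hif : ∀ (b : Bool) (U : EvalState Ag), (bif b then some U else none) = some st' →
      U = st' ∧ b = true := by
    rintro (_ | _) U h
    · simp at h
    · simpa using h
  have hif' : ∀ (b : Bool) (U V : List Bool), (bif b then some U else none) = some V →
      b = true := by
    rintro (_ | _) U V h
    · simp at h
    · rfl
  have hif'' : ∀ (p : Prop) (_ : Decidable p) (U V : List Bool),
      (bif decide p then some U else none) = some V → p := fun p _ U V h =>
    of_decide_eq_true (hif' _ U V h)
  cases l with
  | sep => simp [evalStep] at h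
  | knows =>
    refine evalInv_modal hst h fun S T G hm φ hφ => ?_
    have h1 := hif' _ _ _ hm
    rw [decide_eq_true_eq, Finset.card_eq_one] at h1
    obtain ⟨a, rfl⟩ := h1
    exact ⟨.knows a φ, hφ, rfl, by simp [agentLetters, Formula.code]⟩
  | commonK =>
    refine evalInv_modal hst h fun S T G hm φ hφ => ?_
    have h1 := hif'' _ _ _ _ hm
    exact ⟨.commonK ⟨G, h1.1⟩ φ, ⟨h1.2, hφ⟩, rfl, rfl⟩
  | distributedK =>
    refine evalInv_modal hst h fun S T G hm φ hφ => ?_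
    have h1 := hif'' _ _ _ _ hm
    exact ⟨.distributedK ⟨G, h1.1⟩ φ, ⟨h1.2, hφ⟩, rfl, rfl⟩
  | mutualK =>
    refine evalInv_modal hst h fun S T G hm φ hφ => ?_
    have h1 := hif'' _ _ _ _ hm
    exact ⟨.mutualK ⟨G, h1.1⟩ φ, ⟨h1.2, hφ⟩, rfl, rfl⟩
  | agent a =>
    obtain ⟨rfl, hb⟩ := hif _ _ h
    obtain ⟨name, group, rest, occ, stack⟩ := st
    obtain ⟨h1, h2, h3, h4, h5, h6, h7⟩ := hst
    dsimp only at *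
    simp only [Bool.and_eq_true, List.isEmpty_iff, decide_eq_true_eq] at hb
    obtain ⟨rfl, hb⟩ := hb
    refine ⟨φs, ?_, Or.inr rfl, h3, h4, h5, h6, h7⟩
    -- The new agent is smaller than the pending ones and therefore comes first in the sorted list.
    have hs : (insert a group).sort (· ≤ ·) = a :: group.sort (· ≤ ·) :=
      Finset.sort_insert (r := (· ≤ ·)) (fun b hb' => (hb b hb').le)
        (fun ha => lt_irrefl a (hb a ha))
    rw [h1]
    dsimp only
    rw [agentLetters, agentLetters, hs]
    rfl
  | bit b =>
    obtain ⟨rfl, hb⟩ := hif _ _ h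
    obtain ⟨name, group, rest, occ, stack⟩ := st
    obtain ⟨h1, h2, h3, h4, h5, h6, h7⟩ := hst
    dsimp only at *
    rw [decide_eq_true_eq] at hb
    subst hb
    refine ⟨φs, ?_, Or.inl rfl, h3, h4, h5, h6, h7⟩
    rw [h1]
    simp [agentLetters]
  | var =>
    obtain ⟨rfl, hb⟩ := hif _ _ h
    obtain ⟨name, group, rest, occ, stack⟩ := st
    obtain ⟨h1, h2, h3, h4, h5, h6, h7⟩ := hst
    dsimp only at *
    simp only [Bool.and_eq_true, decide_eq_true_eq] at hb
    obtain ⟨⟨rfl, hn⟩, hr⟩ := hb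
    obtain ⟨p, rfl⟩ := exists_encodeNat hn
    refine ⟨.var p :: φs, ?_, Or.inl rfl, ?_, ?_, ?_, ?_, ?_⟩
    · rw [h1]
      simp [agentLetters, Formula.code]
    · intro χ hχ
      rcases List.mem_cons.1 hχ with rfl | hχ
      · trivial
      · exact h3 χ hχ
    · simp [h4, Formula.varOccs]
    · intro x hx
      rcases List.mem_cons.1 hx with rfl | hx
      · simpa using hr
      · exact h5 x hx
    · rw [h6, List.flatMap_cons, ← List.append_assoc, ← List.reverse_append,
        List.take_append_drop]
    · simp [h7]
  | neg =>
    obtain ⟨rfl, hb⟩ := hif _ _ h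
    obtain ⟨name, group, rest, occ, stack⟩ := st
    obtain ⟨h1, h2, h3, h4, h5, h6, h7⟩ := hst
    dsimp only at *
    simp only [Bool.and_eq_true, List.isEmpty_iff, decide_eq_true_eq] at hb
    obtain ⟨⟨rfl, rfl⟩, hs⟩ := hb
    obtain _ | ⟨φ, φs⟩ := φs
    · simp only [List.length_nil] at h7
      omega
    refine ⟨.neg φ :: φs, ?_, Or.inl rfl, ?_, ?_, h5, h6, ?_⟩
    · rw [h1]
      simp [agentLetters, Formula.code]
    · intro χ hχ
      rcases List.mem_cons.1 hχ with rfl | hχ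
      · exact h3 φ (by simp)
      · exact h3 χ (by simp [hχ])
    · simp [h4, Formula.varOccs]
    · simp only [List.length_cons, List.length_tail] at h7 ⊢
      omega
  | imp =>
    obtain ⟨rfl, hb⟩ := hif _ _ h
    obtain ⟨name, group, rest, occ, stack⟩ := st
    obtain ⟨h1, h2, h3, h4, h5, h6, h7⟩ := hst
    dsimp only at *
    simp only [Bool.and_eq_true, List.isEmpty_iff, decide_eq_true_eq] at hb
    obtain ⟨⟨rfl, rfl⟩, hs⟩ := hb
    obtain _ | ⟨φ, _ | ⟨ψ, φs⟩⟩ := φs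
    · simp only [List.length_nil] at h7
      omega
    · simp only [List.length_cons, List.length_nil] at h7
      omega
    refine ⟨.imp φ ψ :: φs, ?_, Or.inl rfl, ?_, ?_, h5, h6, ?_⟩
    · rw [h1]
      simp [agentLetters, Formula.code]
    · intro χ hχ
      rcases List.mem_cons.1 hχ with rfl | hχ
      · exact ⟨h3 φ (by simp), h3 ψ (by simp)⟩
      · exact h3 χ (by simp [hχ])
    · simp [h4, Formula.varOccs]
    · simp only [List.length_cons, List.length_tail] at h7 ⊢
      omega

theorem evalInv_evalWord {X : Set GroupOp} {r : RawModel} {v : List Bool} :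
    ∀ {w : List (Letter Ag)} {st : EvalState Ag},
      evalWord X r ⟨[], ∅, v.reverse, [], []⟩ w = some st → ∃ φs, EvalInv X r v w st φs := by
  intro w
  induction w with
  | nil =>
    intro st h
    have h' : (⟨[], ∅, v.reverse, [], []⟩ : EvalState Ag) = st := Option.some_injective _ h
    subst h'
    exact ⟨[], by simp [agentLetters], Or.inl rfl, by simp, by simp, by simp, by simp, by simp⟩
  | cons l w ih =>
    intro st h
    rw [evalWord_cons] at h
    rcases h0 : evalWord X r ⟨[], ∅, v.reverse, [], []⟩ w with _ | st₀
    · rw [h0] at h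
      simp at h
    · rw [h0] at h
      obtain ⟨φs, hφs⟩ := ih h0
      exact evalInv_step hφs h

end

/-! ### Correctness of the decision procedure -/

section

variable {Ag : Type} [Fintype Ag] [LinearOrder Ag] {X : Set GroupOp} {sim : Bool}

/-! ### Words and their parts between separators -/

theorem splitSep_ne_nil (w : List (Letter Ag)) : splitSep w ≠ [] := by
  cases w with
  | nil => simp [splitSep]
  | cons l w =>
    change (bif l.isSep then _ else _) ≠ []
    cases l.isSep <;> simp

theorem splitSep_append_sep (u w : List (Letter Ag)) (hu : ∀ l ∈ u, l.isSep = false) :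
    splitSep (u ++ .sep :: w) = u :: splitSep w := by
  induction u with
  | nil => rfl
  | cons l u ih =>
    have h := ih fun x hx => hu x (List.mem_cons_of_mem _ hx)
    change (bif l.isSep then [] :: splitSep (u ++ .sep :: w) else
      (l :: (splitSep (u ++ .sep :: w)).headD []) :: (splitSep (u ++ .sep :: w)).tail) = _
    rw [hu l (by simp), h]
    rfl

theorem splitSep_eq_singleton (u : List (Letter Ag)) (hu : ∀ l ∈ u, l.isSep = false) :
    splitSep u = [u] := by
  induction u with
  | nil => rfl
  | cons l u ih =>
    have h := ih fun x hx => hu x (List.mem_cons_of_mem _ hx)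
    change (bif l.isSep then [] :: splitSep u else
      (l :: (splitSep u).headD []) :: (splitSep u).tail) = _
    rw [hu l (by simp), h]
    rfl

/-- A word can be recovered from its parts, so it is the code of an instance as soon as its parts
are those of one. -/
theorem intercalate_splitSep (w : List (Letter Ag)) :
    List.intercalate [.sep] (splitSep w) = w := by
  induction w with
  | nil => rfl
  | cons l w ih =>
    have hne := splitSep_ne_nil w
    change List.intercalate [.sep] (bif l.isSep then [] :: splitSep w else
      (l :: (splitSep w).headD []) :: (splitSep w).tail) = _
    cases hs : splitSep w with
    | nil => exact absurd hs hne
    | cons p ps =>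
      rw [hs] at ih
      cases hl : l.isSep with
      | true =>
        have : l = .sep := by cases l <;> simp_all [Letter.isSep]
        subst this
        rw [Bool.cond_true, List.intercalate_cons_cons, ih]
        rfl
      | false =>
        rw [Bool.cond_false, List.headD_cons, List.tail_cons]
        cases ps with
        | nil => simpa using ih
        | cons q ps =>
          rw [List.intercalate_cons_cons] at ih ⊢
          rw [List.cons_append, List.cons_append, ih]

theorem isSep_bits (l : List Bool) : ∀ x ∈ (l.map Letter.bit : List (Letter Ag)),
    x.isSep = false := by
  intro x hx
  obtain ⟨b, _, rfl⟩ := List.mem_map.1 hx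
  rfl

theorem isSep_agentLetters (G : Finset Ag) : ∀ x ∈ agentLetters G, x.isSep = false := by
  intro x hx
  obtain ⟨b, _, rfl⟩ := List.mem_map.1 hx
  rfl

theorem isSep_code (φ : Formula Ag) : ∀ x ∈ φ.code, x.isSep = false := by
  induction φ with
  | var p =>
    intro x hx
    rcases List.mem_cons.1 hx with rfl | hx
    · rfl
    · exact isSep_bits _ x hx
  | neg φ ih =>
    intro x hx
    rcases List.mem_cons.1 hx with rfl | hx
    · rfl
    · exact ih x hx
  | imp φ ψ ih ih' =>
    intro x hx
    rcases List.mem_cons.1 hx with rfl | hx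
    · rfl
    · rcases List.mem_append.1 hx with hx | hx
      · exact ih x hx
      · exact ih' x hx
  | knows a φ ih =>
    intro x hx
    rcases List.mem_cons.1 hx with rfl | hx
    · rfl
    · rcases List.mem_cons.1 hx with rfl | hx
      · rfl
      · exact ih x hx
  | commonK G φ ih | distributedK G φ ih | mutualK G φ ih =>
    intro x hx
    rcases List.mem_cons.1 hx with rfl | hx
    · rfl
    · rcases List.mem_append.1 hx with hx | hx
      · exact isSep_agentLetters _ x hx
      · exact ih x hx

theorem unary_eq (n : ℕ) :
    (unary n : List (Letter Ag)) = (List.replicate n true).map Letter.bit := by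
  simp [unary]

theorem map_toBit_bits (l : List Bool) :
    ((l.map Letter.bit : List (Letter Ag))).map Letter.toBit = l := by
  rw [List.map_map]
  exact List.map_id l

theorem map_bit_toBit {l : List (Letter Ag)} (hl : l.all Letter.isBit = true) :
    (l.map Letter.toBit).map Letter.bit = l := by
  rw [List.map_map]
  refine (List.map_congr_left fun x hx => ?_).trans (List.map_id l)
  have := List.all_eq_true.1 hl x hx
  cases x <;> simp_all [Letter.isBit, Letter.toBit]

theorem eq_unary {l : List (Letter Ag)} (hl : l.all Letter.toBit = true) :
    unary l.length = l := by
  refine (List.eq_replicate_of_mem fun x hx => ?_).symm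
  have := List.all_eq_true.1 hl x hx
  cases x <;> simp_all [Letter.toBit]

theorem splitSep_code (x : MCInstance Ag X sim) :
    splitSep x.code = [unary x.numStates, unary x.numAbilities, unary x.state.val, x.formula.code,
      (edgeBits x.model).map .bit, (capBits x.model).map .bit,
      (valBits x.model x.formula).map .bit] := by
  rw [MCInstance.code, edgeCode_eq, capCode_eq, valCode_eq, unary_eq, unary_eq, unary_eq,
    splitSep_append_sep _ _ (isSep_bits _), splitSep_append_sep _ _ (isSep_bits _),
    splitSep_append_sep _ _ (isSep_bits _), splitSep_append_sep _ _ (isSep_code _),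
    splitSep_append_sep _ _ (isSep_bits _), splitSep_append_sep _ _ (isSep_bits _),
    splitSep_eq_singleton _ (isSep_bits _)]

theorem consistent_occs {n m : ℕ} (M : Model Ag (Fin n) (Fin m)) (φ : Formula Ag) :
    consistent (occs M φ) = true := by
  simp only [consistent, List.all_eq_true, Bool.or_eq_true, beq_iff_eq, Bool.not_eq_true', occs,
    List.mem_map]
  rintro _ ⟨p, _, rfl⟩ _ ⟨q, _, rfl⟩
  by_cases h : p = q
  · subst h
    exact Or.inr rfl
  · exact Or.inl (beq_eq_false_iff_ne.2 fun h' => h (encodeNat_injective h'))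

theorem decideParts_model {n m : ℕ} (M : Model Ag (Fin n) (Fin m)) (φ : Formula Ag)
    (hφ : φ.InLang X) (hM : sim = true → M.IsSimilarity) (s : Fin n) :
    decideParts X sim n m s φ.code (edgeBits M) (capBits M) (valBits M φ) = true ↔
      M.Sat φ s := by
  have h := evalWord_code X M φ hφ [] [] []
  rw [List.append_nil, List.append_nil] at h
  have hsim : (!sim || M.raw.isSimilarity) = true := by
    cases sim
    · rfl
    · exact (isSimilarity_raw M).2 (hM rfl)
  have hsat : (truth M φ).getD s false = true ↔ M.Sat φ s := getD_setBits _ s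
  rw [decideParts]
  -- The raw model built from the bits of `M` is `M.raw` by definition.
  change (_ && _ && _ && (!sim || M.raw.isSimilarity) && (evalWord X M.raw _ _).elim _ _) = true ↔ _
  rw [h, hsim, length_edgeBits, length_capBits, ← hsat]
  simp [EvalState.accepts, consistent_occs]

theorem decideWord_code (x : MCInstance Ag X sim) :
    decideWord X sim x.code = true ↔ x.Yes := by
  have h1 : ∀ l : List Bool, (l.map Letter.bit : List (Letter Ag)).all Letter.isBit = true :=
    fun l => by simp [Letter.isBit]
  have h2 : ∀ n, (unary n : List (Letter Ag)).all Letter.toBit = true :=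
    fun n => by simp [unary, Letter.toBit]
  have h3 : ∀ n, (unary n : List (Letter Ag)).length = n := fun n => by simp [unary]
  rw [MCInstance.Yes, ← decideParts_model x.model x.formula x.formula_inLang x.model_similarity,
    decideWord, splitSep_code, Bool.and_eq_true]
  simp only [wellFormed, List.getD_cons_zero, List.getD_cons_succ, h1, h2, h3, map_toBit_bits]
  simp

theorem flatMap_eq_of_map_eq {L : List ℕ} {B : ℕ → List Bool} :
    ∀ {occ : List (List Bool × List Bool)},
      occ.map Prod.fst = L.map Computability.encodeNat →
      (∀ x ∈ occ, ∀ p, x.1 = Computability.encodeNat p → B p = x.2) →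
      L.flatMap B = occ.flatMap Prod.snd := by
  induction L with
  | nil =>
    intro occ h _
    rw [List.map_nil, List.map_eq_nil_iff] at h
    rw [h]
    rfl
  | cons p L ih =>
    intro occ h hB
    cases occ with
    | nil => simp at h
    | cons x occ =>
      rw [List.map_cons, List.map_cons, List.cons.injEq] at h
      rw [List.flatMap_cons, List.flatMap_cons, hB x (by simp) p h.1,
        ih h.2 fun y hy => hB y (List.mem_cons_of_mem _ hy)]

/-- The invariant `EvalInv` supplies the formula: the final stack has height one, so there is
exactly one. The lengths of `e` and `c` supply the model, and the recorded occurrences its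
valuation. -/
theorem exists_of_decideParts {n m k : ℕ} {f : List (Letter Ag)} {e c v : List Bool}
    (h : decideParts X sim n m k f e c v = true) :
    ∃ (M : Model Ag (Fin n) (Fin m)) (s : Fin n) (φ : Formula Ag), φ.InLang X ∧
      (sim = true → M.IsSimilarity) ∧ s.val = k ∧ φ.code = f ∧ edgeBits M = e ∧ capBits M = c ∧
      valBits M φ = v := by
  simp only [decideParts, Bool.and_eq_true, decide_eq_true_eq, beq_iff_eq] at h
  obtain ⟨⟨⟨⟨hk, he⟩, hc⟩, hsim⟩, hw⟩ := h
  rcases hst : evalWord X ⟨n, m, e, c⟩ ⟨[], ∅, v.reverse, [], []⟩ f with _ | st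
  · rw [hst] at hw
    simp at hw
  rw [hst, Option.elim_some] at hw
  simp only [EvalState.accepts, Bool.and_eq_true, List.isEmpty_iff, decide_eq_true_eq,
    beq_iff_eq] at hw
  obtain ⟨⟨⟨⟨⟨hname, hgroup⟩, hrest⟩, hstack⟩, hcons⟩, -⟩ := hw
  obtain ⟨φs, hφs⟩ := evalInv_evalWord hst
  obtain ⟨φ, rfl⟩ : ∃ φ, φs = [φ] := List.length_eq_one_iff.1 (hφs.stack ▸ hstack)
  have hf := hφs.word
  have hv := hφs.bits
  have hn := hφs.names
  rw [hname, hgroup] at hf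
  rw [hrest] at hv
  simp only [List.flatMap_cons, List.flatMap_nil, List.append_nil, List.map_nil, List.nil_append,
    agentLetters, Finset.sort_empty, List.reverse_nil] at hf hv hn
  -- A variable is made true where some occurrence of it says so; by consistency all its occurrences
  -- then say the same.
  obtain ⟨M, rfl, rfl, hM⟩ := exists_model (Ag := Ag) (n := n) (m := m) e c he hc
    fun s => {p | ∃ x ∈ st.occ, x.1 = Computability.encodeNat p ∧ x.2.getD s false = true}
  refine ⟨M, ⟨k, hk⟩, φ, hφs.inLang φ (by simp), ?_, rfl, hf.symm, rfl, rfl, ?_⟩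
  · intro h
    rw [h] at hsim
    exact (isSimilarity_raw M).1 hsim
  · rw [hv, valBits]
    refine flatMap_eq_of_map_eq hn fun x hx p hp => ?_
    refine (eq_setBits (hφs.lengths x hx) fun s => ?_).symm
    rw [hM]
    constructor
    · exact fun h => ⟨x, hx, hp, h⟩
    · rintro ⟨y, hy, hyp, h⟩
      have h1 := List.all_eq_true.1 (List.all_eq_true.1 hcons x hx) y hy
      rw [hp, hyp] at h1
      simp only [beq_self_eq_true, Bool.not_true, Bool.false_or, beq_iff_eq] at h1
      rwa [h1]

theorem exists_of_decideWord {w : List (Letter Ag)} (h : decideWord X sim w = true) :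
    ∃ x : MCInstance Ag X sim, x.code = w := by
  have hw := intercalate_splitSep w
  rw [decideWord, Bool.and_eq_true, wellFormed] at h
  generalize splitSep w = p at h hw
  obtain ⟨h1, h2⟩ := h
  simp only [Bool.and_eq_true, beq_iff_eq] at h1
  obtain ⟨⟨⟨⟨⟨⟨hl, ha⟩, hb⟩, hc⟩, he⟩, hg⟩, hv⟩ := h1
  match p, hl with
  | [p₀, p₁, p₂, p₃, p₄, p₅, p₆], _ =>
    simp only [List.getD_cons_zero, List.getD_cons_succ] at *
    obtain ⟨M, s, φ, hφ, hM, hs, hf, hE, hC, hV⟩ := exists_of_decideParts h2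
    refine ⟨⟨_, _, M, s, φ, hφ, hM⟩, ?_⟩
    rw [MCInstance.code, edgeCode_eq, capCode_eq, valCode_eq]
    dsimp only
    rw [hE, hC, hV, hs, hf, map_bit_toBit he, map_bit_toBit hg, map_bit_toBit hv, eq_unary ha,
      eq_unary hb, eq_unary hc, ← hw]
    simp [List.intercalate]

theorem problemInP_modelChecking (X : Set GroupOp) (sim : Bool) :
    ProblemInP (fun x : MCInstance Ag X sim => x.code) (fun x => x.Yes) := by
  -- This reversal undoes the one in `PolyTime.mem_P`.
  have h : PolyTime fun w : List (Letter Ag) => decideWord X sim w.reverse :=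
    (polyTime_decideWord X sim).comp (by fun_prop)
  refine ⟨_, h.mem_P, fun x => ?_, fun w hw => ?_⟩
  · change decideWord X sim x.code.reverse.reverse = true ↔ _
    rw [List.reverse_reverse]
    exact decideWord_code x
  · have hw' : decideWord X sim w.reverse.reverse = true := hw
    rw [List.reverse_reverse] at hw'
    exact exists_of_decideWord hw'

/-! ### The length of the code of an instance -/

/-- Only variables take more than one letter, namely one plus the number of digits. The induction
uses an arbitrary upper bound `k` on the number of digits, because the subformulas of an implication
may have different maxima. -/
theorem length_code_le (φ : Formula Ag) : φ.code.length ≤ φ.length * (φ.nameLength + 1) := by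
  have hmono : ∀ (ψ : Formula Ag) (k : ℕ), ψ.nameLength ≤ k →
      ψ.code.length ≤ ψ.length * (k + 1) := by
    intro ψ k
    have hG : ∀ G : AgentGroup Ag, (agentLetters G.1).length = G.1.card := fun G => by
      simp [agentLetters]
    induction ψ with
    | var p =>
      intro h
      simp only [Formula.nameLength] at h
      simp only [Formula.code, Formula.length, List.length_cons, List.length_map]
      omega
    | neg φ ih =>
      intro h
      have := ih h
      simp only [Formula.code, Formula.length, List.length_cons, Nat.add_mul]
      omega
    | imp φ ψ ih ih' =>
      intro h
      have h' := max_le_iff.1 h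
      have h1 := ih h'.1
      have h2 := ih' h'.2
      simp only [Formula.code, Formula.length, List.length_cons, List.length_append, Nat.add_mul]
      omega
    | knows a φ ih =>
      intro h
      have := ih h
      simp only [Formula.code, Formula.length, List.length_cons, Nat.add_mul]
      omega
    | commonK G φ ih | distributedK G φ ih | mutualK G φ ih =>
      intro h
      have h1 := ih h
      have h2 : G.1.card ≤ 2 * G.1.card * (k + 1) := by
        rw [Nat.mul_succ]
        omega
      simp only [Formula.code, Formula.length, List.length_cons, List.length_append, hG,
        Nat.add_mul]
      omega
  exact hmono φ _ le_rfl

theorem length_varOccs_le (φ : Formula Ag) : φ.varOccs.length ≤ φ.length := by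
  induction φ with
  | var p => exact le_rfl
  | imp φ ψ ih ih' => simp only [Formula.varOccs, Formula.length, List.length_append]; omega
  | _ => simp only [Formula.varOccs, Formula.length]; omega

theorem exists_polynomial_length_code (X : Set GroupOp) (sim : Bool) :
    ∃ q : Polynomial ℕ, ∀ x : MCInstance Ag X sim,
      x.code.length ≤ q.eval (x.size + x.formula.nameLength) := by
  -- The quadratic term bounds the code of the formula. The number 5 counts `n`, `m`, the state, the
  -- edge bits and the valuation bits, each at most the size; the capability bits account for
  -- `Fintype.card Ag`, the separators for 6.
  refine ⟨Polynomial.X * (Polynomial.X + 1) +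
    Polynomial.C (Fintype.card Ag + 5) * Polynomial.X + 6, fun x => ?_⟩
  have h0 : x.formula.length + (x.numStates + x.numAbilities + x.numStates ^ 2 * x.numAbilities +
      x.numStates * x.formula.length) + 1 ≤ x.size := by
    unfold MCInstance.size
    omega
  have h1 := length_code_le x.formula
  have h2 : x.formula.length * (x.formula.nameLength + 1) ≤
      (x.size + x.formula.nameLength) * (x.size + x.formula.nameLength + 1) :=
    Nat.mul_le_mul (by omega) (by omega)
  have h3 := x.state.isLt
  have h4 : (valBits x.model x.formula).length ≤ x.numStates * x.formula.length := by
    rw [valBits, length_flatMap_of_length _ _ fun p => length_setBits _, Nat.mul_comm]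
    exact Nat.mul_le_mul_left _ (length_varOccs_le _)
  have h5 : Fintype.card Ag * x.numAbilities ≤
      Fintype.card Ag * (x.size + x.formula.nameLength) := Nat.mul_le_mul_left _ (by omega)
  have h6 : x.numStates ^ 2 * x.numAbilities = x.numStates * x.numStates * x.numAbilities := by
    rw [pow_two]
  have hu : ∀ n, (unary n : List (Letter Ag)).length = n := fun n => by simp [unary]
  simp only [MCInstance.code, edgeCode_eq, capCode_eq, valCode_eq, List.length_append,
    List.length_cons, List.length_map, hu, length_edgeBits, length_capBits, Polynomial.eval_add,
    Polynomial.eval_mul, Polynomial.eval_X, Polynomial.eval_C, Polynomial.eval_ofNat,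
    Polynomial.eval_one, Nat.add_mul (Fintype.card Ag) 5]
  omega

end

end WeightedEpistemic

/-- The model checking problem is in P for each of the sixteen logics, and the words that represent
the instances have length polynomial in the size of the input (and the length of variable names). -/
theorem mainTheorem9 (Ag : Type) [Fintype Ag] [LinearOrder Ag] [Nonempty Ag]
    (X : Set WeightedEpistemic.GroupOp) (sim : Bool) :
    WeightedEpistemic.ProblemInP
        (fun x : WeightedEpistemic.MCInstance Ag X sim => x.code) (fun x => x.Yes) ∧
      ∃ q : Polynomial ℕ, ∀ x : WeightedEpistemic.MCInstance Ag X sim,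
        x.code.length ≤ q.eval (x.size + x.formula.nameLength) :=
  ⟨WeightedEpistemic.problemInP_modelChecking X sim,
    WeightedEpistemic.exists_polynomial_length_code X sim⟩
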